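/- **Setting.** Let $K$ be a field, $n\ge 2$, ${\bf a}=(a_1,\dots,a_n)$ integers with all $a_i\ge 2$, and ${\bf q}=(q_{ij})$ an $n\times n$ matrix over $K$ with $q_{ii}=1$ and $q_{ij}q_{ji}=1$ for all $i,j$. The quantum complete intersection is $$A=A({\bf q},{\bf a})=K\langle x_1,\dots,x_n\rangle/\langle x_i^{a_i},\ x_jx_i-q_{ij}x_ix_j\rangle ,$$ with standard basis $x_{\bf v}=x_1^{v_1}\cdots x_n^{v_n}$, ${\bf v}\in V=\{{\bf v}\in\mathbb N_0^n: v_i\le a_i-1\}$, and dual basis $x_{\bf v}^*$. Write ${\bf a-1}=(a_1-1,\dots,a_n-1)$. The canonical Nakayama automorphism $\mathcal N$ is the algebra automorphism of $A$ with $x_{\bf a-1}^*(yz)=x_{\bf a-1}^*(z\,\mathcal N(y))$ for all $y,z\in A$. For ${\bf u},{\bf v}\in\mathbb Z^n$ put $${\bf q}^{\langle {\bf u}|{\bf v}\rangle}=\prod_{i<j}q_{ij}^{u_jv_i},\qquad h_{\bf v}=\frac{{\bf q}^{\langle{\bf a-1-v}|{\bf v}\rangle}}{{\bf q}^{\langle{\bf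 v}|{\bf a-1-v}\rangle}},$$ so $h_{{\bf e}_i}=\prod_j q_{ij}^{a_j-1}$ for the unit vectors ${\bf e}_i$. A permutation $\pi\in S_n$ acts by $\pi({\bf v})=(v_{\pi^{-1}(1)},\dots,v_{\pi^{-1}(n)})$; it is *compatible* if $a_{\pi(i)}=a_i$ and $q_{\pi(i)\pi(j)}=q_{ji}$ for all $i,j$. For such $\pi$ let $$\begin{aligned} I_1&=\{i:\pi(i)=i,\ h_{{\bf e}_i}=1,\ a_i \text{ even}\}, & I_3&=\{i:\pi(i)=i,\ h_{{\bf e}_i}=-1,\ a_i\text{ even}\},\\ I_4&=\{i:\pi(i)=i,\ h_{{\bf e}_i}=-1,\ a_i\text{ odd}\}, & J_3&=\{i:\pi(i)\neq i,\ h_{{\bf e}_i}=-1,\ a_i\text{ even}\}.\end{aligned}$$ A *bi-Frobenius structure* on $A$ is a quadruple $(A,\phi,t,S)$, where $A$ also carries a coalgebra structure $(\Delta,\varepsilon)$ over $K$, $\phi\in A^*$, $t\in A$ and $S(y)=\sum\phi(t_1y)t_2$, such that: $\varepsilon$ is an algebra map and $\Delta(1)=1\otimes1$; every element of $A^*$ has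 the form $y\mapsto\phi(yz)$ with $z\in A$, and every element of $A$ has the form $\sum f(t_1)t_2$ with $f\in A^*$; and $S$ is an algebra anti-homomorphism and a coalgebra anti-homomorphism. Its antipode $S$ is a *permutation antipode* if there are a permutation $\sigma$ of $V$ and scalars $c_{\bf v}\in K$ with $S(x_{\bf v})=c_{\bf v}x_{\sigma({\bf v})}$ for all ${\bf v}\in V$. **Theorem.** Assume that $\operatorname{char}K\ne2$ and $\sqrt{-1}\notin K$. Then $A$ admits a bi-Frobenius structure with permutation antipode if and only if $\mathcal N^2=\mathrm{Id}$ and there is a compatible permutation $\pi\in S_n$ with $\pi^2=\mathrm{Id}$ such that (1) $|I_3|+|I_4|=0$, and (2) $|I_1|\neq 0$ or $|J_3|/2$ is even. If this is the case, then for every such $\pi$ there are $c_1,\dots,c_n\in K$ with $$c_ic_{\pi(i)}=h_{{\bf e}_i}\ (1\le i\le n),\qquad \prod_{j<k}\big({\bf q}^{\langle\pi({\bf e}_k)|\pi({\bf e}_j)\rangle}\big)^{(a_j-1)(a_k-1)}\prod_{i}c_i^{a_i-1}=1,$$ and for every such choice of $\pi$ and of the $c_i$, $(A,\ x_{\bf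 a-1}^*,\ x_{\bf a-1},\ S)$ is a bi-Frobenius structure with permutation antipode, where $\varepsilon(x_{\bf v})=\delta_{{\bf v},{\bf 0}}$ for ${\bf v}\in V$, $\Delta(1)=1\otimes1$, $\Delta(x_{\bf v})=1\otimes x_{\bf v}+x_{\bf v}\otimes1$ for ${\bf v}\in V\setminus\{{\bf 0},{\bf a-1}\}$, $$\Delta(x_{\bf a-1})=\sum_{{\bf v}\in V}g_{\bf v}\;x_{\bf a-1-v}\otimes x_{\pi({\bf v})},\qquad g_{\bf v}=\frac{1}{{\bf q}^{\langle{\bf a-1-v}|{\bf v}\rangle}}\prod_ic_i^{v_i}\prod_{j<k}\big({\bf q}^{\langle\pi({\bf e}_k)|\pi({\bf e}_j)\rangle}\big)^{v_jv_k},$$ and $$S(x_{\bf v})=\prod_ic_i^{v_i}\prod_{j<k}\big({\bf q}^{\langle\pi({\bf e}_k)|\pi({\bf e}_j)\rangle}\big)^{v_jv_k}\;x_{\pi({\bf v})}\qquad({\bf v}\in V).$$ -/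

import Mathlib

open scoped TensorProduct

/-- A bi-Frobenius algebra structure `(A, φ, t, S)` on a `K`-algebra `A`: a coalgebra structure on `A`
together with `φ ∈ A^*`, `t ∈ A` and the linear map `S(x) = ∑ φ(t₁ x) t₂`, such that the counit is an
algebra map and `1` is group-like, `(A, φ)` is a Frobenius algebra, `(A, t)` is a Frobenius coalgebra,
and `S` is an anti-homomorphism of algebras and of coalgebras. -/
structure BiFrobeniusStructure (K A : Type*) [Field K] [Ring A] [Algebra K A]
    extends Coalgebra K A where
  finite : Module.Finite K A
  φ : Module.Dual K A
  t : A
  S : A →ₗ[K] A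
  /-- `S(x) = ∑ φ(t₁ x) t₂`. -/
  S_def : ∀ x : A,
    S x = TensorProduct.lid K A ((φ ∘ₗ LinearMap.mulRight K x).rTensor A (comul t))
  counit_one : counit 1 = 1
  counit_mul : ∀ x y : A, counit (x * y) = counit x * counit y
  comul_one : comul 1 = (1 : A) ⊗ₜ[K] (1 : A)
  /-- `A^* = A ⇀ φ`, where `(z ⇀ φ)(x) = φ(x z)`. -/
  frobenius_algebra : ∀ f : Module.Dual K A, ∃ z : A, ∀ x : A, f x = φ (x * z)
  /-- `A = t ↼ A^*`, where `t ↼ f = ∑ f(t₁) t₂`. -/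
  frobenius_coalgebra : ∀ x : A, ∃ f : Module.Dual K A,
    x = TensorProduct.lid K A (f.rTensor A (comul t))
  S_one : S 1 = 1
  S_mul : ∀ x y : A, S (x * y) = S y * S x
  counit_S : ∀ x : A, counit (S x) = counit x
  /-- `Δ(S(x)) = ∑ S(x₂) ⊗ S(x₁)`. -/
  comul_S : ∀ x : A, comul (S x) = TensorProduct.map S S (TensorProduct.comm K A A (comul x))

namespace QuantumCI

/-- The defining relations `x_i ^ a_i = 0` and `x_j x_i = q_ij x_i x_j`. -/
inductive Rel {K : Type*} [Field K] {n : ℕ} (q : Matrix (Fin n) (Fin n) K) (a : Fin n → ℕ) :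
    FreeAlgebra K (Fin n) → FreeAlgebra K (Fin n) → Prop
  | pow (i : Fin n) : Rel q a (FreeAlgebra.ι K i ^ a i) 0
  | comm (i j : Fin n) : Rel q a (FreeAlgebra.ι K j * FreeAlgebra.ι K i)
      (q i j • (FreeAlgebra.ι K i * FreeAlgebra.ι K j))

/-- The quantum complete intersection
`A(q, a) = K⟨x_1, …, x_n⟩ / ⟨x_i ^ a_i, x_j x_i - q_ij x_i x_j⟩`. -/
abbrev Alg {K : Type*} [Field K] {n : ℕ} (q : Matrix (Fin n) (Fin n) K) (a : Fin n → ℕ) :=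
  RingQuot (Rel q a)

section

variable {K : Type*} [Field K] {n : ℕ} (q : Matrix (Fin n) (Fin n) K) (a : Fin n → ℕ)

/-- The generator `x_i`. -/
def x (i : Fin n) : Alg q a := RingQuot.mkAlgHom K (Rel q a) (FreeAlgebra.ι K i)

/-- The ordered monomial `x_v = x_1 ^ v_1 ⋯ x_n ^ v_n`. -/
def mon (v : Fin n → ℕ) : Alg q a := (List.ofFn fun i => x q a i ^ v i).prod

/-- The vector `a - 1` (all `a_i` are at least `2` where this is used). -/
def top : Fin n → ℕ := fun i => a i - 1

/-- The set `V` of the exponents `v` with `0 ≤ v_i ≤ a_i - 1`; the `x_v` with `v ∈ V` form the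
standard basis of `A(q, a)`. -/
def V : Finset (Fin n → ℕ) := Finset.Iic (top a)

/-- `φ` is the dual basis vector `x_{a-1}^*` of the standard basis. -/
def IsTopDual (φ : Module.Dual K (Alg q a)) : Prop :=
  ∀ v ∈ V a, φ (mon q a v) = if v = top a then 1 else 0

/-- `N` is the canonical Nakayama automorphism, that is, the (unique) algebra automorphism with
`φ(y z) = φ(z N(y))` for the functional `φ = x_{a-1}^*`. -/
def IsCanonicalNakayama (N : Alg q a ≃ₐ[K] Alg q a) : Prop :=
  ∃ φ : Module.Dual K (Alg q a), IsTopDual q a φ ∧ ∀ y z, φ (y * z) = φ (z * N y)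

/-- `𝒩² = Id` for the canonical Nakayama automorphism `𝒩`. -/
def NakayamaSqEqId : Prop :=
  ∃ N : Alg q a ≃ₐ[K] Alg q a, IsCanonicalNakayama q a N ∧ ∀ y, N (N y) = y

/-- The structure coefficient `q^⟨u|v⟩ = ∏_{i < j} q_ij ^ (u_j v_i)`, for `u, v ∈ ℤⁿ`. -/
def coeff (u v : Fin n → ℤ) : K := ∏ i, ∏ j ∈ Finset.Ioi i, q i j ^ (u j * v i)

/-- `h_v = q^⟨a-1-v|v⟩ / q^⟨v|a-1-v⟩`, for `v ∈ ℤⁿ`. -/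
def h (v : Fin n → ℤ) : K :=
  coeff q (fun i => (a i : ℤ) - 1 - v i) v / coeff q v (fun i => (a i : ℤ) - 1 - v i)

/-- The unit vector `e_i` of `ℤⁿ`. -/
def e (i : Fin n) : Fin n → ℤ := Pi.single i 1

/-- The action `π(v) = (v_{π⁻¹(1)}, …, v_{π⁻¹(n)})` of a permutation. -/
def act {R : Type*} (π : Equiv.Perm (Fin n)) (v : Fin n → R) : Fin n → R := fun i => v (π⁻¹ i)

/-- `π` is a compatible permutation: `a_{π(i)} = a_i` and `q_{π(i)π(j)} = q_ji`. -/
def Compatible (π : Equiv.Perm (Fin n)) : Prop :=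
  (∀ i, a (π i) = a i) ∧ ∀ i j, q (π i) (π j) = q j i

/-- `I_1`: fixed points `i` of `π` with `h_{e_i} = 1` and `a_i` even. -/
def I₁ (π : Equiv.Perm (Fin n)) : Set (Fin n) := {i | π i = i ∧ h q a (e i) = 1 ∧ Even (a i)}

/-- `I_3`: fixed points `i` of `π` with `h_{e_i} = -1` and `a_i` even. -/
def I₃ (π : Equiv.Perm (Fin n)) : Set (Fin n) := {i | π i = i ∧ h q a (e i) = -1 ∧ Even (a i)}

/-- `I_4`: fixed points `i` of `π` with `h_{e_i} = -1` and `a_i` odd. -/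
def I₄ (π : Equiv.Perm (Fin n)) : Set (Fin n) := {i | π i = i ∧ h q a (e i) = -1 ∧ Odd (a i)}

/-- `J_3`: non-fixed points `i` of `π` with `h_{e_i} = -1` and `a_i` even. -/
def J₃ (π : Equiv.Perm (Fin n)) : Set (Fin n) := {i | π i ≠ i ∧ h q a (e i) = -1 ∧ Even (a i)}

/-- `π` is a compatible permutation with `π² = Id`, `|I_3| + |I_4| = 0`, and `|I_1| ≠ 0` or `|J_3|/2`
even. (If `𝒩² = Id`, then `J_3` is stable under the fixed-point free involution `π`, so the division
is exact.) -/
def GoodInvolution (π : Equiv.Perm (Fin n)) : Prop :=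
  Compatible q a π ∧ π ^ 2 = 1 ∧ (I₃ q a π).ncard + (I₄ q a π).ncard = 0 ∧
    ((I₁ q a π).ncard ≠ 0 ∨ Even ((J₃ q a π).ncard / 2))

/-- `∏_{j < k} (q^⟨π(e_k)|π(e_j)⟩) ^ (v_j v_k)`. -/
def permCoeff (π : Equiv.Perm (Fin n)) (v : Fin n → ℕ) : K :=
  ∏ j, ∏ k ∈ Finset.Ioi j, coeff q (act π (e k)) (act π (e j)) ^ (v j * v k)

/-- The equations on the scalars `c_i`: `c_i c_{π(i)} = h_{e_i}` and `q_π ∏ c_i ^ (a_i - 1) = 1`,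
where `q_π = ∏_{j < k} (q^⟨π(e_k)|π(e_j)⟩) ^ ((a_k - 1)(a_j - 1))`. -/
def ScalarEquations (π : Equiv.Perm (Fin n)) (c : Fin n → K) : Prop :=
  (∀ i, c i * c (π i) = h q a (e i)) ∧ permCoeff q π (top a) * ∏ i, c i ^ (a i - 1) = 1

/-- The coefficient `g_{a-1-v, π(v)}` of the comultiplication. -/
def g (π : Equiv.Perm (Fin n)) (c : Fin n → K) (v : Fin n → ℕ) : K :=
  (coeff q (fun i => (a i : ℤ) - 1 - v i) (fun i => v i))⁻¹ * (∏ i, c i ^ v i) * permCoeff q π v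

variable {q a}

/-- The antipode is a permutation antipode: `S(x_v) = c_v x_{σ(v)}` for a permutation `σ` of `V` and
scalars `c_v`. -/
def IsPermutationAntipode (B : BiFrobeniusStructure K (Alg q a)) : Prop :=
  ∃ (σ : Equiv.Perm {v // v ∈ V a}) (c : {v // v ∈ V a} → K),
    ∀ v : {v // v ∈ V a}, B.S (mon q a v) = c v • mon q a (σ v)

/-- `B` is the explicit structure attached to `π` and the scalars `c_i`: `φ = x_{a-1}^*`,
`t = x_{a-1}`, `ε(x_v) = δ_{v,0}`, `Δ(1) = 1 ⊗ 1`, `Δ(x_v) = 1 ⊗ x_v + x_v ⊗ 1` for `v ≠ 0, a-1`,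
`Δ(x_{a-1}) = ∑_v g_{a-1-v,π(v)} x_{a-1-v} ⊗ x_{π(v)}` and
`S(x_v) = ∏ c_i ^ v_i ∏_{j < k} (q^⟨π(e_k)|π(e_j)⟩) ^ (v_j v_k) x_{π(v)}`. -/
structure IsExplicit (π : Equiv.Perm (Fin n)) (c : Fin n → K)
    (B : BiFrobeniusStructure K (Alg q a)) : Prop where
  φ_eq : IsTopDual q a B.φ
  t_eq : B.t = mon q a (top a)
  counit_eq : ∀ v ∈ V a, B.counit (mon q a v) = if v = 0 then 1 else 0
  comul_one_eq : B.comul 1 = (1 : Alg q a) ⊗ₜ[K] (1 : Alg q a)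
  comul_eq : ∀ v ∈ V a, v ≠ 0 → v ≠ top a →
    B.comul (mon q a v) = (1 : Alg q a) ⊗ₜ[K] mon q a v + mon q a v ⊗ₜ[K] (1 : Alg q a)
  comul_top : B.comul (mon q a (top a)) =
    ∑ v ∈ V a, g q a π c v • (mon q a (top a - v) ⊗ₜ[K] mon q a (act π v))
  S_eq : ∀ v ∈ V a, B.S (mon q a v) = ((∏ i, c i ^ v i) * permCoeff q π v) • mon q a (act π v)

end

end QuantumCI

/-! Necessity. In any bi-Frobenius structure on `A` the counit kills the nilpotent generators and `t
* y = ε(y) t`, so `t` is a multiple of the socle element `x_{a-1}` and hence a two-sided integral.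
This yields `S t = t` and `φ (S (S w) * y) = φ (y * w)`: the inverse of `S²` is the Nakayama
automorphism of `φ`. An antipode that permutes monomials up to scalars satisfies `S x_i = c_i
x_{π(i)}`, and the relations of `A` make `π` compatible. Testing the formula for `S²` on generators
gives `π² = 1` and `c_i c_{π(i)} = h_{e_i}`; `S t = t` gives the product equation. Compatibility
inverts `h_{e_i}` along `π`, whereas `c_i c_{π(i)}` is symmetric, so `h_{e_i} = ±1`, which amounts
to `𝒩² = Id` (`scalarEquations_of_biFrobenius`, `good_of_permutationAntipode`).

Sufficiency. A compatible `π` and any scalars `c_i` define an anti-endomorphism. Duality then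
dictates `Δ(x_{a-1})`, and the monomials strictly between `1` and `x_{a-1}` are declared primitive,
which makes coassociativity automatic. Anti-comultiplicativity of `S` reduces to `S²` being the
diagonal scaling by the `h_{e_i}` (`antipodeCoeff_mul_act`).

Scalars. It remains to decide when the `c_i` exist. A fixed point with `h = -1` would need `c_i² =
-1`, whence condition (1). At a point of `I_1` the sign of `c_i` is free and enters the product with
odd exponent `a_i - 1`, so the product can be corrected. Without such a point everything pairs off
along `π`, and the product equals `(-1)^(|J_3|/2)`, whence condition (2). -/

namespace QuantumCI

/-! ### The structure coefficients as a bicharacter. -/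

section Coeff

variable {K : Type*} [Field K] {n : ℕ} {q : Matrix (Fin n) (Fin n) K}

theorem prod_Ioi_eq_prod_ite {M : Type*} [CommMonoid M] (j : Fin n) (f : Fin n → M) :
    ∏ k ∈ Finset.Ioi j, f k = ∏ k, if j < k then f k else 1 := by
  rw [← Finset.prod_filter]
  congr 1
  ext k
  simp

theorem coeff_eq_prod_ite (q : Matrix (Fin n) (Fin n) K) (u v : Fin n → ℤ) :
    coeff q u v = ∏ i, ∏ j, if i < j then q i j ^ (u j * v i) else 1 := by
  simp only [coeff, prod_Ioi_eq_prod_ite]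

theorem coeff_ne_zero (hq : ∀ i j, q i j ≠ 0) (u v : Fin n → ℤ) : coeff q u v ≠ 0 :=
  Finset.prod_ne_zero_iff.2 fun i _ => Finset.prod_ne_zero_iff.2 fun j _ =>
    zpow_ne_zero _ (hq i j)

theorem coeff_add_left (hq : ∀ i j, q i j ≠ 0) (u u' v : Fin n → ℤ) :
    coeff q (u + u') v = coeff q u v * coeff q u' v := by
  simp only [coeff, ← Finset.prod_mul_distrib]
  refine Finset.prod_congr rfl fun i _ => Finset.prod_congr rfl fun j _ => ?_
  rw [← zpow_add₀ (hq i j), Pi.add_apply, add_mul]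

theorem coeff_add_right (hq : ∀ i j, q i j ≠ 0) (u v v' : Fin n → ℤ) :
    coeff q u (v + v') = coeff q u v * coeff q u v' := by
  simp only [coeff, ← Finset.prod_mul_distrib]
  refine Finset.prod_congr rfl fun i _ => Finset.prod_congr rfl fun j _ => ?_
  rw [← zpow_add₀ (hq i j), Pi.add_apply, mul_add]

@[simp] theorem coeff_zero_left (v : Fin n → ℤ) : coeff q 0 v = 1 := by simp [coeff]

@[simp] theorem coeff_zero_right (u : Fin n → ℤ) : coeff q u 0 = 1 := by simp [coeff]

theorem coeff_e_right (u : Fin n → ℤ) (i : Fin n) :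
    coeff q u (e i) = ∏ j, if i < j then q i j ^ u j else 1 := by
  rw [coeff_eq_prod_ite, Finset.prod_eq_single i]
  · simp [e]
  · intro b _ hb
    simp [e, hb]
  · simp

theorem coeff_e_left (v : Fin n → ℤ) (i : Fin n) :
    coeff q (e i) v = ∏ j, if j < i then q j i ^ v j else 1 := by
  rw [coeff_eq_prod_ite, Finset.prod_comm, Finset.prod_eq_single i]
  · simp [e]
  · intro b _ hb
    simp [e, hb]
  · simp

theorem coeff_e_e (i j : Fin n) : coeff q (e j) (e i) = if i < j then q i j else 1 := by
  rw [coeff_e_right, Finset.prod_eq_single j]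
  · simp [e]
  · intro b _ hb
    simp [e, hb]
  · simp

theorem coeff_e_comm (hq : ∀ i, q i i = 1) (hqq : ∀ i j, q i j * q j i = 1) (i j : Fin n) :
    coeff q (e j) (e i) = q i j * coeff q (e i) (e j) := by
  rw [coeff_e_e, coeff_e_e]
  rcases lt_trichotomy i j with h | rfl | h
  · simp [h, h.not_gt]
  · simp [hq]
  · simp [h, h.not_gt, hqq]

theorem entry_ne_zero (hqq : ∀ i j, q i j * q j i = 1) (i j : Fin n) : q i j ≠ 0 :=
  left_ne_zero_of_mul_eq_one (hqq i j)

/-- The structure coefficient for exponents in `ℕⁿ`. -/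
abbrev natCoeff (q : Matrix (Fin n) (Fin n) K) (u v : Fin n → ℕ) : K :=
  coeff q (fun i => (u i : ℤ)) (fun i => (v i : ℤ))

theorem cast_add_vec (u v : Fin n → ℕ) :
    (fun i => (((u + v) i : ℕ) : ℤ)) = (fun i => (u i : ℤ)) + fun i => (v i : ℤ) := by
  ext i; simp

theorem cast_single (i : Fin n) :
    (fun j => (((Pi.single i 1 : Fin n → ℕ) j : ℕ) : ℤ)) = e i := by
  ext j
  simp only [e, Pi.single_apply]
  split_ifs <;> simp

theorem cast_zero_vec : (fun j => (((0 : Fin n → ℕ) j : ℕ) : ℤ)) = 0 := by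
  ext j; simp

theorem natCoeff_zero_left (v : Fin n → ℕ) : natCoeff q 0 v = 1 := by
  rw [natCoeff, cast_zero_vec, coeff_zero_left]

theorem natCoeff_zero_right (v : Fin n → ℕ) : natCoeff q v 0 = 1 := by
  rw [natCoeff, cast_zero_vec, coeff_zero_right]

end Coeff

/-! ### Multiplication of monomials and the standard basis. -/

section Monomials

variable {K : Type*} [Field K] {n : ℕ} {q : Matrix (Fin n) (Fin n) K} {a : Fin n → ℕ}

theorem x_pow (i : Fin n) : x q a i ^ a i = 0 := by
  have := RingQuot.mkAlgHom_rel K (Rel.pow (q := q) (a := a) i)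
  simpa [x] using this

theorem x_mul_x (i j : Fin n) : x q a j * x q a i = q i j • (x q a i * x q a j) := by
  have := RingQuot.mkAlgHom_rel K (Rel.comm (q := q) (a := a) i j)
  simpa [x] using this

theorem x_mul_x_pow (i j : Fin n) (m : ℕ) :
    x q a j * x q a i ^ m = q i j ^ m • (x q a i ^ m * x q a j) := by
  induction m with
  | zero => simp
  | succ m ih =>
    rw [pow_succ, ← mul_assoc, ih, smul_mul_assoc, mul_assoc, x_mul_x, mul_smul_comm, smul_smul,
      mul_assoc, pow_succ]

theorem mon_eq_prod_finRange (v : Fin n → ℕ) :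
    mon q a v = ((List.finRange n).map fun i => x q a i ^ v i).prod := by
  rw [mon, List.ofFn_eq_map]

/-- `x_i` moves right past each `x_k ^ v_k` with `k < i`, collecting `q k i ^ v k`, and stops at its
own slot. General sorted lists are needed because the induction peels off the first factor. -/
theorem x_mul_list_prod (v : Fin n → ℕ) (i : Fin n) (l : List (Fin n)) (hl : l.Pairwise (· < ·))
    (hi : i ∈ l) :
    x q a i * (l.map fun k => x q a k ^ v k).prod =
      (l.map fun k => if k < i then q k i ^ v k else 1).prod •
        (l.map fun k => x q a k ^ (v + Pi.single i 1 : Fin n → ℕ) k).prod := by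
  induction l with
  | nil => simp at hi
  | cons k l ih =>
    rw [List.pairwise_cons] at hl
    simp only [List.map_cons, List.prod_cons]
    rcases eq_or_ne i k with rfl | hik
    · have h1 : (l.map fun k => if k < i then q k i ^ v k else 1) = l.map fun _ => 1 :=
        List.map_congr_left fun k hk => if_neg (hl.1 k hk).not_gt
      have h2 : (l.map fun k => x q a k ^ (v + Pi.single i 1 : Fin n → ℕ) k) =
          l.map fun k => x q a k ^ v k :=
        List.map_congr_left fun k hk => by simp [(hl.1 k hk).ne']
      rw [h1, h2]
      simp [← mul_assoc, pow_succ']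
    · have hil : i ∈ l := by simpa [hik] using hi
      have hki : k < i := hl.1 i hil
      rw [← mul_assoc, x_mul_x_pow, smul_mul_assoc, mul_assoc, ih hl.2 hil, mul_smul_comm,
        smul_smul, if_pos hki]
      simp [hik.symm]

theorem x_mul_mon (i : Fin n) (v : Fin n → ℕ) :
    x q a i * mon q a v =
      natCoeff q (Pi.single i 1) v • mon q a (v + Pi.single i 1) := by
  rw [mon_eq_prod_finRange, mon_eq_prod_finRange,
    x_mul_list_prod v i _ (List.pairwise_lt_finRange n) (List.mem_finRange i), natCoeff,
    cast_single, coeff_e_left]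
  congr 1
  rw [← List.ofFn_eq_map, List.prod_ofFn]
  simp

@[simp] theorem mon_zero : mon q a 0 = 1 := by
  simp [mon_eq_prod_finRange]

theorem vec_induction {P : (Fin n → ℕ) → Prop} (h0 : P 0)
    (hs : ∀ v i, P v → P (v + Pi.single i 1)) (v : Fin n → ℕ) : P v := by
  induction hm : ∑ i, v i generalizing v with
  | zero =>
    have : v = 0 := by
      ext i
      exact (Finset.sum_eq_zero_iff.1 hm) i (Finset.mem_univ i)
    exact this ▸ h0
  | succ m ih =>
    obtain ⟨i, -, hi⟩ : ∃ i ∈ Finset.univ, v i ≠ 0 := by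
      by_contra! hc
      rw [Finset.sum_eq_zero hc] at hm
      omega
    have hv : v = v - Pi.single i 1 + Pi.single i 1 := by
      ext j
      rcases eq_or_ne j i with rfl | hj
      · simp; omega
      · simp [hj]
    rw [hv]
    refine hs _ _ (ih _ ?_)
    rw [hv] at hm
    simp only [Pi.add_apply, Finset.sum_add_distrib, Finset.sum_pi_single', Finset.mem_univ,
      if_true] at hm
    simpa using hm

theorem mon_add_single (hq : ∀ i j, q i j ≠ 0) (v : Fin n → ℕ) (i : Fin n) :
    mon q a (v + Pi.single i 1) = (natCoeff q (Pi.single i 1) v)⁻¹ • (x q a i * mon q a v) := by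
  rw [x_mul_mon, smul_smul, inv_mul_cancel₀ (coeff_ne_zero hq _ _), one_smul]

/-- Induction on `u`, one generator at a time, with bimultiplicativity of `coeff`. No bound on the
exponents is needed, which spares case distinctions later. -/
theorem mon_mul_mon (hq : ∀ i j, q i j ≠ 0) (u v : Fin n → ℕ) :
    mon q a u * mon q a v = natCoeff q u v • mon q a (u + v) := by
  induction u using vec_induction with
  | h0 => simp only [natCoeff_zero_left, mon_zero, one_mul, zero_add, one_smul]
  | hs u i ih =>
    rw [mon_add_single hq, smul_mul_assoc, mul_assoc, ih, mul_smul_comm, x_mul_mon, smul_smul,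
      smul_smul, add_right_comm]
    congr 1
    simp only [natCoeff, cast_add_vec, coeff_add_left hq, coeff_add_right hq]
    have := coeff_ne_zero hq (fun j => (((Pi.single i 1 : Fin n → ℕ) j : ℕ) : ℤ)) (fun j => (u j : ℤ))
    field_simp

theorem mon_single (i : Fin n) : mon q a (Pi.single i 1) = x q a i := by
  have := x_mul_mon (q := q) (a := a) i 0
  simpa only [natCoeff_zero_right, mon_zero, mul_one, zero_add, one_smul] using this.symm

theorem mem_V {v : Fin n → ℕ} (ha : ∀ i, 2 ≤ a i) : v ∈ V a ↔ ∀ i, v i < a i := by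
  simp only [V, Finset.mem_Iic, Pi.le_def, top]
  exact forall_congr' fun i => by have := ha i; omega

theorem mem_V_iff_le {v : Fin n → ℕ} : v ∈ V a ↔ v ≤ top a := by simp [V]

theorem mon_eq_zero (ha : ∀ i, 2 ≤ a i) {v : Fin n → ℕ} (hv : v ∉ V a) : mon q a v = 0 := by
  rw [mem_V ha] at hv
  push Not at hv
  obtain ⟨i, hi⟩ := hv
  rw [mon_eq_prod_finRange]
  refine List.prod_eq_zero (List.mem_map.2 ⟨i, List.mem_finRange i, ?_⟩)
  rw [← Nat.add_sub_cancel' hi, pow_add, x_pow, zero_mul]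

/-- Left multiplication by `x_i` on the standard basis. -/
noncomputable def shift (q : Matrix (Fin n) (Fin n) K) (a : Fin n → ℕ) (i : Fin n) :
    Module.End K ((Fin n → ℕ) →₀ K) :=
  Finsupp.linearCombination K fun v =>
    if v i + 1 < a i then Finsupp.single (v + Pi.single i 1) (natCoeff q (Pi.single i 1) v) else 0

theorem shift_single (i : Fin n) (v : Fin n → ℕ) (r : K) :
    shift q a i (Finsupp.single v r) = if v i + 1 < a i then
      r • Finsupp.single (v + Pi.single i 1) (natCoeff q (Pi.single i 1) v) else 0 := by
  rw [shift, Finsupp.linearCombination_single]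
  split_ifs <;> simp

theorem shift_pow_single (i : Fin n) (m : ℕ) (v : Fin n → ℕ) (r : K) (hm : a i ≤ v i + (m + 1)) :
    (shift q a i ^ (m + 1)) (Finsupp.single v r) = 0 := by
  induction m generalizing v r with
  | zero => simp [shift_single]; omega
  | succ m ih =>
    rw [pow_succ, Module.End.mul_apply, shift_single]
    split_ifs with h
    · rw [map_smul, ih _ _ (by simp; omega), smul_zero]
    · simp

/-- For `i ≠ j` the two truncation conditions do not interact, so both sides vanish together;
otherwise the identity is `coeff_e_comm`. -/
theorem shift_mul_shift (hq : ∀ i, q i i = 1) (hqq : ∀ i j, q i j * q j i = 1) (i j : Fin n) :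
    shift q a j * shift q a i = q i j • (shift q a i * shift q a j) := by
  rcases eq_or_ne i j with rfl | hij
  · simp [hq]
  have h0 := entry_ne_zero hqq
  refine Finsupp.lhom_ext fun v r => ?_
  simp only [Module.End.mul_apply, LinearMap.smul_apply, shift_single]
  by_cases hi : v i + 1 < a i <;> by_cases hj : v j + 1 < a j <;>
    simp only [hi, hj, if_true, if_false, map_smul, shift_single, Pi.add_apply, Pi.single_apply,
      hij, hij.symm, add_zero, smul_zero, map_zero]
  rw [add_right_comm]
  simp only [Finsupp.smul_single]
  congr 1
  simp only [natCoeff, cast_add_vec, cast_single, coeff_add_right h0, smul_eq_mul,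
    coeff_e_comm hq hqq i j]
  ring

/-- The regular representation of `A(q, a)` in the coordinates of the standard basis. -/
noncomputable def rep (ha : ∀ i, 2 ≤ a i) (hq : ∀ i, q i i = 1) (hqq : ∀ i j, q i j * q j i = 1) :
    Alg q a →ₐ[K] Module.End K ((Fin n → ℕ) →₀ K) :=
  RingQuot.liftAlgHom K ⟨FreeAlgebra.lift K (shift q a), by
    intro y z hr
    induction hr with
    | pow i =>
      simp only [map_pow, FreeAlgebra.lift_ι_apply, map_zero]
      refine Finsupp.lhom_ext fun v r => ?_
      obtain ⟨m, hm⟩ : ∃ m, a i = m + 1 := ⟨a i - 1, by have := ha i; omega⟩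
      rw [hm]
      exact shift_pow_single i m v r (by omega)
    | comm i j =>
      simp only [map_mul, FreeAlgebra.lift_ι_apply, map_smul]
      exact shift_mul_shift hq hqq i j⟩

theorem rep_x (ha : ∀ i, 2 ≤ a i) (hq : ∀ i, q i i = 1) (hqq : ∀ i j, q i j * q j i = 1)
    (i : Fin n) : rep ha hq hqq (x q a i) = shift q a i := by
  simp [rep, x]

/-- Acting on the vector of exponent `0` separates the monomials; this is the source of their linear
independence. -/
theorem rep_mon (ha : ∀ i, 2 ≤ a i) (hq : ∀ i, q i i = 1) (hqq : ∀ i j, q i j * q j i = 1)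
    (v : Fin n → ℕ) (hv : v ∈ V a) :
    rep ha hq hqq (mon q a v) (Finsupp.single 0 1) = Finsupp.single v 1 := by
  induction v using vec_induction with
  | h0 => simp
  | hs v i ih =>
    have h0 := entry_ne_zero hqq
    rw [mem_V ha] at hv ih
    have hi := hv i
    simp only [Pi.add_apply, Pi.single_eq_same] at hi
    rw [mon_add_single h0, map_smul, map_mul, LinearMap.smul_apply, Module.End.mul_apply,
      ih fun j => lt_of_le_of_lt (by simp) (hv j), rep_x, shift_single, if_pos hi, one_smul,
      Finsupp.smul_single, smul_eq_mul, inv_mul_cancel₀ (coeff_ne_zero h0 _ _)]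

/-- The span contains `1` and is stable under left multiplication by the generators, hence is
everything. -/
theorem span_mon (ha : ∀ i, 2 ≤ a i) :
    Submodule.span K (Set.range fun v : {v // v ∈ V a} => mon q a v) = ⊤ := by
  set W := Submodule.span K (Set.range fun v : {v // v ∈ V a} => mon q a v) with hW
  have hmem : ∀ v, mon q a v ∈ W := fun v => by
    by_cases hv : v ∈ V a
    · exact Submodule.subset_span ⟨⟨v, hv⟩, rfl⟩
    · rw [mon_eq_zero ha hv]; exact W.zero_mem
  have key : ∀ y : FreeAlgebra K (Fin n), ∀ z ∈ W, RingQuot.mkAlgHom K (Rel q a) y * z ∈ W := by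
    intro y
    induction y with
    | grade0 r =>
      intro z hz
      rw [AlgHom.commutes, ← Algebra.smul_def]
      exact W.smul_mem r hz
    | grade1 i =>
      intro z hz
      induction hz using Submodule.span_induction with
      | mem z hz =>
        obtain ⟨v, rfl⟩ := hz
        change x q a i * mon q a v ∈ W
        rw [x_mul_mon]
        exact W.smul_mem _ (hmem _)
      | zero => rw [mul_zero]; exact W.zero_mem
      | add y z _ _ hy hz => rw [mul_add]; exact W.add_mem hy hz
      | smul r y _ hy => rw [mul_smul_comm]; exact W.smul_mem r hy
    | mul y y' hy hy' =>
      intro z hz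
      rw [map_mul, mul_assoc]
      exact hy _ (hy' z hz)
    | add y y' hy hy' =>
      intro z hz
      rw [map_add, add_mul]
      exact W.add_mem (hy z hz) (hy' z hz)
  rw [eq_top_iff]
  intro y _
  obtain ⟨y, rfl⟩ := RingQuot.mkAlgHom_surjective K (Rel q a) y
  have := key y 1 (by simpa using hmem 0)
  rwa [mul_one] at this

theorem linearIndependent_mon (ha : ∀ i, 2 ≤ a i) (hq : ∀ i, q i i = 1)
    (hqq : ∀ i j, q i j * q j i = 1) :
    LinearIndependent K fun v : {v // v ∈ V a} => mon q a v := by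
  let f : Alg q a →ₗ[K] ((Fin n → ℕ) →₀ K) :=
    (LinearMap.applyₗ (Finsupp.single 0 1)).comp (rep ha hq hqq).toLinearMap
  refine LinearIndependent.of_comp f ?_
  have : (f ∘ fun v : {v // v ∈ V a} => mon q a v) =
      (fun v : Fin n → ℕ => Finsupp.single v (1 : K)) ∘ Subtype.val := by
    ext1 v
    exact rep_mon ha hq hqq v v.2
  rw [this]
  exact (Finsupp.linearIndependent_single_one K _).comp _ Subtype.val_injective

/-- The standard basis of `A(q, a)`. -/
noncomputable def monBasis (ha : ∀ i, 2 ≤ a i) (hq : ∀ i, q i i = 1)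
    (hqq : ∀ i j, q i j * q j i = 1) : Module.Basis {v // v ∈ V a} K (Alg q a) :=
  Module.Basis.mk (linearIndependent_mon ha hq hqq) (span_mon ha).ge

@[simp] theorem monBasis_apply (ha : ∀ i, 2 ≤ a i) (hq : ∀ i, q i i = 1)
    (hqq : ∀ i j, q i j * q j i = 1) (v : {v // v ∈ V a}) :
    monBasis ha hq hqq v = mon q a v := by
  simp [monBasis]

end Monomials

end QuantumCI

/-! ### Integrals and the square of the antipode in a general bi-Frobenius algebra. -/

namespace BiFrobeniusStructure

variable {K A : Type*} [Field K] [Ring A] [Algebra K A] (B : BiFrobeniusStructure K A)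

theorem eq_of_forall_φ_mul {x y : A} (hxy : ∀ z, B.φ (x * z) = B.φ (y * z)) : x = y := by
  refine Module.eval_apply_injective K (LinearMap.ext fun f => ?_)
  rw [Module.Dual.eval_apply, Module.Dual.eval_apply]
  obtain ⟨z, hz⟩ := B.frobenius_algebra f
  rw [hz, hz, hxy]

/-- The two Frobenius conditions combine: `y = ∑ f(t₁) t₂` with `f = φ(· z)` says `y = S z`. -/
theorem S_surjective : Function.Surjective B.S := by
  intro y
  obtain ⟨f, hf⟩ := B.frobenius_coalgebra y
  obtain ⟨z, hz⟩ := B.frobenius_algebra f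
  refine ⟨z, ?_⟩
  rw [hf, B.S_def]
  congr 3
  ext w
  simp [hz]

theorem S_injective : Function.Injective B.S := by
  have := B.finite
  exact LinearMap.injective_iff_surjective.2 B.S_surjective

/-- Apply `ε` to `S y = ∑ φ(t₁ y) t₂`: the counit axiom turns the right side into `φ(t y)`, and `ε ∘
S = ε`. -/
theorem φ_t_mul (y : A) : B.φ (B.t * y) = B.counit y := by
  let _ := B.toCoalgebra
  let r := Coalgebra.Repr.arbitrary K B.t
  have hS : B.S y = ∑ i ∈ r.index, B.φ (r.left i * y) • r.right i := by
    rw [B.S_def]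
    change TensorProduct.lid K A ((B.φ ∘ₗ LinearMap.mulRight K y).rTensor A
      (Coalgebra.comul B.t)) = _
    rw [← r.eq]
    simp
  have ht : ∑ i ∈ r.index, Coalgebra.counit (R := K) (r.right i) • r.left i = B.t := by
    have := congrArg (TensorProduct.rid K A) (Coalgebra.sum_tmul_counit_eq r)
    simpa only [map_sum, TensorProduct.rid_tmul, one_smul] using this
  rw [← B.counit_S, hS]
  conv_lhs => rw [← ht]
  simp only [Finset.sum_mul, map_sum, smul_mul_assoc, map_smul, smul_eq_mul]
  exact Finset.sum_congr rfl fun i _ => mul_comm _ _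

theorem t_mul (y : A) : B.t * y = B.counit y • B.t := by
  refine B.eq_of_forall_φ_mul fun z => ?_
  rw [mul_assoc, φ_t_mul, B.counit_mul, smul_mul_assoc, map_smul, φ_t_mul, smul_eq_mul]

theorem φ_t : B.φ B.t = 1 := by
  simpa [B.counit_one] using B.φ_t_mul 1

/-- `S t = ∑ φ(t₁ t) t₂ = φ(t) ∑ ε(t₁) t₂ = t`, since `φ(t) = 1`. -/
theorem S_t (ht : ∀ y, y * B.t = B.counit y • B.t) : B.S B.t = B.t := by
  let _ := B.toCoalgebra
  let r := Coalgebra.Repr.arbitrary K B.t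
  have h1 : ∑ i ∈ r.index, Coalgebra.counit (R := K) (r.left i) • r.right i = B.t :=
    Coalgebra.sum_counit_smul r
  rw [B.S_def]
  change TensorProduct.lid K A ((B.φ ∘ₗ LinearMap.mulRight K B.t).rTensor A
      (Coalgebra.comul B.t)) = _
  rw [← r.eq]
  simp only [map_sum, LinearMap.rTensor_tmul, LinearMap.comp_apply, LinearMap.mulRight_apply, ht,
    map_smul, B.φ_t, TensorProduct.lid_tmul, smul_eq_mul, mul_one]
  exact h1

/-- If `t` is a two-sided integral, then `S⁻²` is the Nakayama automorphism of `φ`. -/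
theorem φ_S_S_mul (ht : ∀ y, y * B.t = B.counit y • B.t) (w y : A) :
    B.φ (B.S (B.S w) * y) = B.φ (y * w) := by
  let _ := B.toCoalgebra
  let r := Coalgebra.Repr.arbitrary K B.t
  have hS : ∀ z, B.S z = ∑ i ∈ r.index, B.φ (r.left i * z) • r.right i := fun z => by
    rw [B.S_def]
    change TensorProduct.lid K A ((B.φ ∘ₗ LinearMap.mulRight K z).rTensor A
      (Coalgebra.comul B.t)) = _
    rw [← r.eq]
    simp
  -- Because `S t = t`, the tensor `Δ(t)` has a second expansion; using it in the definition of `S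
  -- y` and cancelling the injective `S` expands `y` itself.
  have hΔ : B.comul B.t = ∑ i ∈ r.index, B.S (r.right i) ⊗ₜ[K] B.S (r.left i) := by
    conv_lhs => rw [← B.S_t ht]
    rw [B.comul_S]
    change TensorProduct.map B.S B.S (TensorProduct.comm K A A (Coalgebra.comul B.t)) = _
    rw [← r.eq]
    simp
  have hy : y = ∑ i ∈ r.index, B.φ (B.S (r.right i) * y) • r.left i := by
    apply B.S_injective
    rw [B.S_def, hΔ]
    simp
  conv_rhs => rw [hy]
  rw [hS w]
  simp only [map_sum, map_smul, Finset.sum_mul, smul_mul_assoc, smul_eq_mul]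
  exact Finset.sum_congr rfl fun i _ => mul_comm _ _

end BiFrobeniusStructure

namespace QuantumCI

/-! ### Antihomomorphisms on monomials, and the scalars `h`. -/

section Twist

variable {K : Type*} [Field K] {n : ℕ} {q : Matrix (Fin n) (Fin n) K} {a : Fin n → ℕ}
  {π : Equiv.Perm (Fin n)}

theorem act_single (π : Equiv.Perm (Fin n)) (i : Fin n) :
    act π (Pi.single i 1 : Fin n → ℕ) = Pi.single (π i) 1 := by
  ext j
  simp only [act, Pi.single_apply, Equiv.Perm.inv_eq_iff_eq]

theorem act_e (π : Equiv.Perm (Fin n)) (i : Fin n) : act π (e i) = e (π i) := by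
  ext j
  simp only [act, e, Pi.single_apply, Equiv.Perm.inv_eq_iff_eq]

theorem act_add (π : Equiv.Perm (Fin n)) (u v : Fin n → ℕ) : act π (u + v) = act π u + act π v :=
  rfl

theorem act_act (hπ : π ^ 2 = 1) (v : Fin n → ℕ) : act π (act π v) = v := by
  ext i
  have : π⁻¹ (π⁻¹ i) = i := by
    rw [← Equiv.Perm.mul_apply, ← mul_inv_rev, ← sq, hπ]; rfl
  exact congrArg v this

theorem act_top (hπ : ∀ i, a (π i) = a i) : act π (top a) = top a := by
  ext i
  have := hπ (π⁻¹ i)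
  rw [show π (π⁻¹ i) = i from π.apply_symm_apply i] at this
  simp only [act, top, this]

theorem act_mem_V (hπ : ∀ i, a (π i) = a i) {v : Fin n → ℕ} : act π v ∈ V a ↔ v ∈ V a := by
  rw [mem_V_iff_le, mem_V_iff_le]
  conv_lhs => rw [← act_top hπ]
  simp only [Pi.le_def, act]
  exact π⁻¹.forall_congr_right (q := fun i => v i ≤ top a i)

theorem natCoeff_single_left (v : Fin n → ℕ) (i : Fin n) :
    natCoeff q (Pi.single i 1) v = ∏ j, if j < i then q j i ^ v j else 1 := by
  rw [natCoeff, cast_single, coeff_e_left]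
  simp

theorem natCoeff_act_single (hq : ∀ i j, q i j ≠ 0) (v : Fin n → ℕ) (i : Fin n) :
    natCoeff q (act π v) (Pi.single (π i) 1) =
      ∏ j, coeff q (act π (e j)) (act π (e i)) ^ v j := by
  induction v using vec_induction with
  | h0 =>
    have : act π (0 : Fin n → ℕ) = 0 := rfl
    rw [this, natCoeff_zero_left]
    simp
  | hs v k ih =>
    rw [act_add, natCoeff, cast_add_vec, coeff_add_left hq]
    rw [natCoeff] at ih
    rw [ih, act_single, cast_single, cast_single]
    simp only [Pi.add_apply, pow_add, Finset.prod_mul_distrib]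
    congr 1
    rw [Finset.prod_eq_single k]
    · simp [act_e]
    · intro b _ hb
      simp [hb]
    · simp

@[simp] theorem permCoeff_zero : permCoeff q π 0 = 1 := by simp [permCoeff]

/-- The exponent `v_j v_k` is bilinear, and its `e_i`-`e_i` term never occurs because only pairs `j
< k` enter. -/
theorem permCoeff_add_single (v : Fin n → ℕ) (i : Fin n) :
    permCoeff q π (v + Pi.single i 1) = permCoeff q π v *
      (∏ k, if i < k then coeff q (act π (e k)) (act π (e i)) ^ v k else 1) *
      ∏ j, if j < i then coeff q (act π (e i)) (act π (e j)) ^ v j else 1 := by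
  simp only [permCoeff, prod_Ioi_eq_prod_ite]
  have h1 : (∏ k, if i < k then coeff q (act π (e k)) (act π (e i)) ^ v k else 1) =
      ∏ j, ∏ k, if j < k then coeff q (act π (e k)) (act π (e j)) ^
        ((Pi.single i 1 : Fin n → ℕ) j * v k) else 1 := by
    rw [Finset.prod_eq_single (a := i) (s := Finset.univ)
      (f := fun j => ∏ k, if j < k then coeff q (act π (e k)) (act π (e j)) ^
        ((Pi.single i 1 : Fin n → ℕ) j * v k) else 1)]
    · simp
    · intro b _ hb
      simp [hb]
    · simp
  have h2 : (∏ j, if j < i then coeff q (act π (e i)) (act π (e j)) ^ v j else 1) =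
      ∏ j, ∏ k, if j < k then coeff q (act π (e k)) (act π (e j)) ^
        (v j * (Pi.single i 1 : Fin n → ℕ) k) else 1 := by
    refine Finset.prod_congr rfl fun j _ => ?_
    rw [Finset.prod_eq_single (a := i) (s := Finset.univ)
      (f := fun k => if j < k then coeff q (act π (e k)) (act π (e j)) ^
        (v j * (Pi.single i 1 : Fin n → ℕ) k) else 1)]
    · simp
    · intro b _ hb
      simp [hb]
    · simp
  rw [h1, h2]
  simp only [← Finset.prod_mul_distrib]
  refine Finset.prod_congr rfl fun j _ => Finset.prod_congr rfl fun k _ => ?_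
  split_ifs with hjk
  · rw [← pow_add, ← pow_add]
    congr 1
    by_cases hj : j = i <;> by_cases hk : k = i
    · exact absurd hjk (by rw [hj, hk]; exact lt_irrefl _)
    · subst hj; simp [hk]; ring
    · subst hk; simp [hj]; ring
    · simp [hj, hk]
  · simp

/-- The inductive step of `antihom_mon`, checked factor by factor. For `j > i` both sides agree
outright; for `j < i` compatibility lets `q j i` swap `e (π i)` and `e (π j)`. -/
theorem permCoeff_step (hq : ∀ i, q i i = 1) (hqq : ∀ i j, q i j * q j i = 1)
    (hπ : ∀ i j, q (π i) (π j) = q j i) (v : Fin n → ℕ) (i : Fin n) :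
    natCoeff q (Pi.single i 1) v * permCoeff q π (v + Pi.single i 1) =
      permCoeff q π v * natCoeff q (act π v) (Pi.single (π i) 1) := by
  rw [permCoeff_add_single, natCoeff_single_left, natCoeff_act_single (entry_ne_zero hqq)]
  suffices key : (∏ k, if i < k then coeff q (act π (e k)) (act π (e i)) ^ v k else 1) *
      ((∏ j, if j < i then q j i ^ v j else 1) *
        ∏ j, if j < i then coeff q (act π (e i)) (act π (e j)) ^ v j else 1) =
      ∏ j, coeff q (act π (e j)) (act π (e i)) ^ v j by
    linear_combination permCoeff q π v * key
  simp only [← Finset.prod_mul_distrib]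
  refine Finset.prod_congr rfl fun j _ => ?_
  rcases lt_trichotomy j i with h | rfl | h
  · simp only [h, h.not_gt, if_true, if_false, one_mul, act_e]
    rw [← mul_pow, coeff_e_comm hq hqq (π j) (π i), hπ, ← mul_assoc, hqq, one_mul]
  · simp [act_e, coeff_e_e]
  · simp [h, h.not_gt]

/-- Stated for an arbitrary antihomomorphism because it serves both the given antipode in the
necessity part and the constructed one. -/
theorem antihom_mon (hq : ∀ i, q i i = 1) (hqq : ∀ i j, q i j * q j i = 1)
    (hπ : ∀ i j, q (π i) (π j) = q j i) {c : Fin n → K} (S : Alg q a →ₗ[K] Alg q a)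
    (S_one : S 1 = 1) (S_mul : ∀ y z, S (y * z) = S z * S y)
    (hS : ∀ i, S (x q a i) = c i • x q a (π i)) (v : Fin n → ℕ) :
    S (mon q a v) = ((∏ i, c i ^ v i) * permCoeff q π v) • mon q a (act π v) := by
  have h0 := entry_ne_zero hqq
  induction v using vec_induction with
  | h0 =>
    have : act π (0 : Fin n → ℕ) = 0 := rfl
    rw [this, mon_zero, S_one]
    simp
  | hs v i ih =>
    have hc : (∏ j, c j ^ (v + Pi.single i 1 : Fin n → ℕ) j) = (∏ j, c j ^ v j) * c i := by
      simp only [Pi.add_apply, pow_add, Finset.prod_mul_distrib]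
      congr 1
      rw [Finset.prod_eq_single i]
      · simp
      · intro b _ hb
        simp [hb]
      · simp
    rw [mon_add_single h0, map_smul, S_mul, ih, hS, ← mon_single, smul_mul_smul_comm,
      mon_mul_mon h0, smul_smul, smul_smul, hc, act_add, act_single]
    congr 1
    rw [mul_assoc, inv_mul_eq_iff_eq_mul₀ (coeff_ne_zero h0 _ _)]
    linear_combination -(∏ j, c j ^ v j) * c i * permCoeff_step hq hqq hπ v i

theorem h_eq_natCoeff {v : Fin n → ℕ} (hv : v ∈ V a)
    (ha : ∀ i, 2 ≤ a i) :
    h q a (fun i => (v i : ℤ)) = natCoeff q (top a - v) v / natCoeff q v (top a - v) := by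
  have : (fun i => (a i : ℤ) - 1 - v i) = fun i => (((top a - v) i : ℕ) : ℤ) := by
    ext i
    have h1 := (mem_V ha).1 hv i
    simp only [top, Pi.sub_apply]
    omega
  rw [h, this]

/-- The factor `coeff q u u` cancels between numerator and denominator, so `a - 1 - u` may be
replaced by the fixed vector `a - 1`. -/
theorem h_add (hq : ∀ i j, q i j ≠ 0) (u v : Fin n → ℤ) : h q a (u + v) = h q a u * h q a v := by
  have key : ∀ u : Fin n → ℤ, h q a u =
      coeff q (fun i => (a i : ℤ) - 1) u / coeff q u (fun i => (a i : ℤ) - 1) := fun u => by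
    have h1 : (fun i => (a i : ℤ) - 1) = (fun i => (a i : ℤ) - 1 - u i) + u := by
      ext i; simp
    rw [h1, coeff_add_left hq, coeff_add_right hq,
      mul_div_mul_right _ _ (coeff_ne_zero hq _ _)]
    rfl
  rw [key, key, key, coeff_add_left hq, coeff_add_right hq, mul_div_mul_comm]

theorem h_ne_zero (hq : ∀ i j, q i j ≠ 0) (u : Fin n → ℤ) : h q a u ≠ 0 :=
  div_ne_zero (coeff_ne_zero hq _ _) (coeff_ne_zero hq _ _)

theorem h_natCast (hq : ∀ i j, q i j ≠ 0) (v : Fin n → ℕ) :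
    h q a (fun i => (v i : ℤ)) = ∏ i, h q a (e i) ^ v i := by
  induction v using vec_induction with
  | h0 =>
    rw [cast_zero_vec]
    simp [h]
  | hs v i ih =>
    rw [cast_add_vec, h_add hq, ih, cast_single]
    simp only [Pi.add_apply, pow_add, Finset.prod_mul_distrib]
    congr 1
    rw [Finset.prod_eq_single i]
    · simp
    · intro b _ hb
      simp [hb]
    · simp

theorem h_e (hq : ∀ i, q i i = 1) (hqq : ∀ i j, q i j * q j i = 1) (i : Fin n) :
    h q a (e i) = ∏ j, q i j ^ ((a j : ℤ) - 1) := by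
  rw [h, coeff_e_right, coeff_e_left, ← Finset.prod_div_distrib]
  refine Finset.prod_congr rfl fun j _ => ?_
  have hji : q j i = (q i j)⁻¹ := eq_inv_of_mul_eq_one_left (hqq j i)
  rcases lt_trichotomy i j with h | rfl | h
  · simp [h, h.not_gt, e, h.ne']
  · simp [hq]
  · simp [h, h.not_gt, e, h.ne, hji, ← zpow_neg]

/-- Compatibility transposes `q`, and transposing inverts its entries. -/
theorem h_e_perm (hq : ∀ i, q i i = 1) (hqq : ∀ i j, q i j * q j i = 1)
    (hπ : Compatible q a π) (i : Fin n) : h q a (e (π i)) = (h q a (e i))⁻¹ := by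
  rw [h_e hq hqq, h_e hq hqq, ← Finset.prod_inv_distrib, ← Equiv.prod_comp π]
  refine Finset.prod_congr rfl fun j _ => ?_
  rw [hπ.2, hπ.1, eq_inv_of_mul_eq_one_left (hqq j i), inv_zpow]

end Twist

/-! ### Solvability of the scalar equations. -/

section Scalars

variable {K : Type*} [Field K] {n : ℕ} {q : Matrix (Fin n) (Fin n) K} {a : Fin n → ℕ}
  {π : Equiv.Perm (Fin n)}

theorem apply_apply_of_sq (h2 : π ^ 2 = 1) (i : Fin n) : π (π i) = i := by
  rw [← Equiv.Perm.mul_apply, ← sq, h2]; rfl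

/-- The pairs contributing to `permCoeff`. -/
def orderedPairs (π : Equiv.Perm (Fin n)) : Finset (Fin n × Fin n) :=
  Finset.univ.filter fun p => p.1 < p.2 ∧ π p.1 < π p.2

theorem permCoeff_eq_prod_orderedPairs (hπ : ∀ i j, q (π i) (π j) = q j i) (v : Fin n → ℕ) :
    permCoeff q π v = ∏ p ∈ orderedPairs π, q p.2 p.1 ^ (v p.1 * v p.2) := by
  rw [orderedPairs, Finset.prod_filter, ← Finset.univ_product_univ, Finset.prod_product]
  simp only [permCoeff, prod_Ioi_eq_prod_ite, act_e, coeff_e_e, hπ]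
  refine Finset.prod_congr rfl fun j _ => Finset.prod_congr rfl fun k _ => ?_
  by_cases h1 : j < k <;> by_cases h2 : π j < π k <;> simp [h1, h2]

theorem map_mem_orderedPairs (h2 : π ^ 2 = 1) {p : Fin n × Fin n} (hp : p ∈ orderedPairs π) :
    (π p.1, π p.2) ∈ orderedPairs π := by
  simp only [orderedPairs, Finset.mem_filter, Finset.mem_univ, true_and,
    apply_apply_of_sq h2] at hp ⊢
  exact hp.symm

theorem pair_cancel (hqq : ∀ i j, q i j * q j i = 1) (hπ : Compatible q a π) (j k : Fin n) :
    q k j ^ (top a j * top a k) * q (π k) (π j) ^ (top a (π j) * top a (π k)) = 1 := by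
  simp only [top, hπ.1, hπ.2]
  rw [← mul_pow, hqq, one_pow]

/-- Applying `π` to both members of a pair permutes `orderedPairs` and inverts each factor, so the
product equals its own inverse. -/
theorem permCoeff_top_sq (hqq : ∀ i j, q i j * q j i = 1) (hπ : Compatible q a π)
    (h2 : π ^ 2 = 1) : permCoeff q π (top a) ^ 2 = 1 := by
  have h : permCoeff q π (top a) =
      ∏ p ∈ orderedPairs π, q (π p.2) (π p.1) ^ (top a (π p.1) * top a (π p.2)) := by
    rw [permCoeff_eq_prod_orderedPairs hπ.2]
    refine Finset.prod_nbij' (fun p => (π p.1, π p.2)) (fun p => (π p.1, π p.2))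
      (fun p => map_mem_orderedPairs h2) (fun p => map_mem_orderedPairs h2) ?_ ?_ ?_ <;>
    · intro p _
      simp [apply_apply_of_sq h2]
  rw [sq]
  nth_rewrite 2 [h]
  rw [permCoeff_eq_prod_orderedPairs hπ.2, ← Finset.prod_mul_distrib]
  exact Finset.prod_eq_one fun p _ => pair_cancel hqq hπ p.1 p.2

/-- Pairs cancel along `π`. In a fixed pair both indices are fixed, so the entry of `q` squares to
`1` while its exponent is even. -/
theorem permCoeff_top_eq_one (hqq : ∀ i j, q i j * q j i = 1) (hπ : Compatible q a π)
    (h2 : π ^ 2 = 1) (hodd : ∀ i, π i = i → Odd (a i)) : permCoeff q π (top a) = 1 := by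
  rw [permCoeff_eq_prod_orderedPairs hπ.2]
  refine Finset.prod_involution (fun p _ => (π p.1, π p.2)) ?_ ?_ ?_ ?_
  · intro p _
    exact pair_cancel hqq hπ p.1 p.2
  · intro p _ hp hfix
    apply hp
    obtain ⟨h1, h3⟩ := Prod.ext_iff.1 hfix
    simp only at h1 h3
    have hq2 : q p.2 p.1 ^ 2 = 1 := by
      have := hπ.2 p.1 p.2
      rw [h1, h3] at this
      rw [sq]
      nth_rewrite 2 [← this]
      exact hqq _ _
    obtain ⟨m, hm⟩ := hodd _ h1
    have : top a p.1 = 2 * m := by simp [top, hm]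
    rw [this, mul_assoc, pow_mul, hq2, one_pow]
  · intro p hp
    exact map_mem_orderedPairs h2 hp
  · intro p _
    simp [apply_apply_of_sq h2]

/-- A two-element orbit contributes `η i ^ (a i - 1)`, which is `-1` exactly when `η i = -1` and `a
i` is even. Fixed points contribute `1`, since there `c i ^ 2 = 1` and `a i - 1` is even. -/
theorem prod_scalars (h2 : π ^ 2 = 1) (haπ : ∀ i, a (π i) = a i) {η c : Fin n → K}
    (hη : ∀ i, η i = 1 ∨ η i = -1) (hηπ : ∀ i, η (π i) = η i)
    (hneg : (1 : K) ≠ -1) (hc : ∀ i, c i * c (π i) = η i)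
    (hfix : ∀ i, π i = i → Odd (a i) ∧ η i = 1) (ha : ∀ i, 2 ≤ a i) :
    ∏ i, c i ^ (a i - 1) =
      (-1) ^ ({i | π i ≠ i ∧ η i = -1 ∧ Even (a i)}.ncard / 2) := by
  classical
  set F := (Finset.univ : Finset (Fin n))
  -- The smaller member represents each two-element orbit.
  set T := F.filter fun i => i < π i with hT
  have hππ := apply_apply_of_sq h2
  have hsplit : ∏ i, c i ^ (a i - 1) = ∏ i ∈ T, η i ^ (a i - 1) := by
    have h1 : ∏ i, c i ^ (a i - 1) = (∏ i ∈ T, c i ^ (a i - 1)) *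
        ((∏ i ∈ F.filter (fun i => π i < i), c i ^ (a i - 1)) *
          ∏ i ∈ F.filter (fun i => π i = i), c i ^ (a i - 1)) := by
      rw [hT, Finset.prod_filter, Finset.prod_filter, Finset.prod_filter,
        ← Finset.prod_mul_distrib, ← Finset.prod_mul_distrib]
      refine Finset.prod_congr rfl fun i _ => ?_
      rcases lt_trichotomy i (π i) with h | h | h
      · simp [h, h.not_gt, h.ne']
      · simp [← h]
      · simp [h, h.not_gt, h.ne]
    have h3 : ∏ i ∈ F.filter (fun i => π i < i), c i ^ (a i - 1) =
        ∏ i ∈ T, c (π i) ^ (a i - 1) := by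
      refine Finset.prod_nbij' π π ?_ ?_ ?_ ?_ ?_
      · intro i hi
        simpa [hT, F, hππ] using hi
      · intro i hi
        simpa [hT, F, hππ] using hi
      · intro i _; exact hππ i
      · intro i _; exact hππ i
      · intro i _
        rw [hππ, haπ]
    have h4 : ∏ i ∈ F.filter (fun i => π i = i), c i ^ (a i - 1) = 1 := by
      refine Finset.prod_eq_one fun i hi => ?_
      have hi' : π i = i := (Finset.mem_filter.1 hi).2
      obtain ⟨⟨m, hm⟩, h1⟩ := hfix i hi'
      have h5 := hc i
      rw [hi', h1, ← sq] at h5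
      rw [hm, Nat.add_sub_cancel, pow_mul, h5, one_pow]
    rw [h1, h3, h4, mul_one, ← Finset.prod_mul_distrib]
    exact Finset.prod_congr rfl fun i _ => by rw [← mul_pow, hc]
  set J := F.filter fun i => π i ≠ i ∧ η i = -1 ∧ Even (a i) with hJ
  have hJcard : {i | π i ≠ i ∧ η i = -1 ∧ Even (a i)}.ncard = J.card := by
    rw [← Set.ncard_coe_finset]
    congr 1
    ext i
    simp [hJ, F]
  have hJ1 : J.card = (J.filter fun i => i < π i).card + (J.filter fun i => i < π i).card := by
    rw [← Finset.card_filter_add_card_filter_not (s := J) fun i => i < π i]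
    congr 1
    refine Finset.card_nbij' π π ?_ ?_ ?_ ?_
    · intro i hi
      simp only [hJ, F, Finset.coe_filter, Finset.mem_filter, Finset.mem_univ, true_and,
        Set.mem_ofPred_eq, hππ, hηπ, haπ, not_lt] at hi ⊢
      exact ⟨⟨fun h => hi.1.1 h.symm, hi.1.2⟩, lt_of_le_of_ne hi.2 hi.1.1⟩
    · intro i hi
      simp only [hJ, F, Finset.coe_filter, Finset.mem_filter, Finset.mem_univ, true_and,
        Set.mem_ofPred_eq, hππ, hηπ, haπ, not_lt] at hi ⊢
      exact ⟨⟨fun h => hi.1.1 h.symm, hi.1.2⟩, hi.2.le⟩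
    · intro i _; exact hππ i
    · intro i _; exact hππ i
  have hJ2 : (J.filter fun i => i < π i) = T.filter fun i => η i = -1 ∧ Even (a i) := by
    ext i
    simp only [hJ, hT, F, Finset.mem_filter, Finset.mem_univ, true_and]
    constructor
    · rintro ⟨h, h'⟩; exact ⟨h', h.2⟩
    · rintro ⟨h, h'⟩; exact ⟨⟨h.ne', h'⟩, h⟩
  rw [hsplit, hJcard, hJ1, ← two_mul, Nat.mul_div_cancel_left _ two_pos, hJ2,
    ← Finset.prod_const, Finset.prod_filter (fun i => η i = -1 ∧ Even (a i))]
  refine Finset.prod_congr rfl fun i _ => ?_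
  rcases hη i with h | h
  · simp [h, hneg]
  · rcases Nat.even_or_odd (a i) with he | ho
    · rw [if_pos ⟨h, he⟩, h]
      exact Odd.neg_one_pow (Nat.Even.sub_odd (by have := ha i; omega) he odd_one)
    · rw [if_neg (fun h' => (Nat.not_even_iff_odd.2 ho) h'.2), h]
      exact Even.neg_one_pow (Nat.Odd.sub_odd ho odd_one)

theorem one_ne_neg_one_of_sq (hi : ∀ z : K, z ^ 2 ≠ -1) : (1 : K) ≠ -1 := fun h =>
  hi 1 (by rw [one_pow]; exact h)

/-- The value of the product in `ScalarEquations` when `I₁`, `I₃` and `I₄` are empty. -/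
theorem permCoeff_mul_prod_scalars (hi : ∀ z : K, z ^ 2 ≠ -1) (ha : ∀ i, 2 ≤ a i)
    (hq : ∀ i, q i i = 1)
    (hqq : ∀ i j, q i j * q j i = 1) (hπ : Compatible q a π) (h2 : π ^ 2 = 1)
    (hh : ∀ i, h q a (e i) = 1 ∨ h q a (e i) = -1) (hI1 : I₁ q a π = ∅) {c : Fin n → K}
    (hc : ∀ i, c i * c (π i) = h q a (e i)) :
    permCoeff q π (top a) * ∏ i, c i ^ (a i - 1) = (-1) ^ ((J₃ q a π).ncard / 2) := by
  have hfix : ∀ i, π i = i → Odd (a i) ∧ h q a (e i) = 1 := fun i hfi => by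
    have h1 : h q a (e i) = 1 := (hh i).resolve_right fun h' =>
      hi (c i) (by rw [sq, ← h', ← hc, hfi])
    refine ⟨?_, h1⟩
    by_contra ho
    have : i ∈ I₁ q a π := ⟨hfi, h1, Nat.not_odd_iff_even.1 ho⟩
    rw [hI1] at this
    exact this
  rw [permCoeff_top_eq_one hqq hπ h2 fun i h' => (hfix i h').1, one_mul, J₃]
  refine prod_scalars h2 hπ.1 hh (fun i => ?_) (one_ne_neg_one_of_sq hi) hc hfix ha
  rw [h_e_perm hq hqq hπ]
  rcases hh i with h | h <;> rw [h] <;> simp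

/-- At a fixed point the first equation reads `c i ^ 2 = h_{e_i}`, so the value `-1` is excluded. -/
theorem goodInvolution_of_scalarEquations (hi : ∀ z : K, z ^ 2 ≠ -1) (ha : ∀ i, 2 ≤ a i)
    (hq : ∀ i, q i i = 1)
    (hqq : ∀ i j, q i j * q j i = 1) (hπ : Compatible q a π) (h2 : π ^ 2 = 1)
    (hh : ∀ i, h q a (e i) = 1 ∨ h q a (e i) = -1) {c : Fin n → K}
    (hc : ScalarEquations q a π c) : GoodInvolution q a π := by
  have hsq : ∀ i, π i = i → h q a (e i) ≠ -1 := fun i hfi h' =>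
    hi (c i) (by rw [sq, ← h', ← hc.1, hfi])
  refine ⟨hπ, h2, ?_, ?_⟩
  · have h3 : I₃ q a π = ∅ := Set.eq_empty_of_forall_notMem fun i h' => hsq i h'.1 h'.2.1
    have h4 : I₄ q a π = ∅ := Set.eq_empty_of_forall_notMem fun i h' => hsq i h'.1 h'.2.1
    rw [h3, h4, Set.ncard_empty]
  · by_cases hI1 : I₁ q a π = ∅
    · right
      have h1 := permCoeff_mul_prod_scalars hi ha hq hqq hπ h2 hh hI1 hc.1
      rw [hc.2] at h1
      by_contra hodd
      rw [(Nat.not_even_iff_odd.1 hodd).neg_one_pow] at h1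
      exact one_ne_neg_one_of_sq hi h1
    · left
      rwa [Ne, Set.ncard_eq_zero]

theorem exists_scalarEquations (hi : ∀ z : K, z ^ 2 ≠ -1) (ha : ∀ i, 2 ≤ a i)
    (hq : ∀ i, q i i = 1)
    (hqq : ∀ i j, q i j * q j i = 1) (hπ : GoodInvolution q a π)
    (hh : ∀ i, h q a (e i) = 1 ∨ h q a (e i) = -1) : ∃ c, ScalarEquations q a π c := by
  obtain ⟨hcomp, h2, hI34, hI⟩ := hπ
  have hππ := apply_apply_of_sq h2
  have hI3 : I₃ q a π = ∅ := by rw [← Set.ncard_eq_zero]; omega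
  have hI4 : I₄ q a π = ∅ := by rw [← Set.ncard_eq_zero]; omega
  have hfix : ∀ i, π i = i → h q a (e i) = 1 := fun i hfi => (hh i).resolve_right fun h' => by
    rcases Nat.even_or_odd (a i) with he | ho
    · exact (hI3 ▸ (⟨hfi, h', he⟩ : i ∈ I₃ q a π) : i ∈ (∅ : Set (Fin n)))
    · exact (hI4 ▸ (⟨hfi, h', ho⟩ : i ∈ I₄ q a π) : i ∈ (∅ : Set (Fin n)))
  have hinv : ∀ i, h q a (e (π i)) = h q a (e i) := fun i => by
    rw [h_e_perm hq hqq hcomp]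
    rcases hh i with h | h <;> rw [h] <;> simp
  -- The larger member of each two-element orbit carries `h`; all other scalars are `1`. Every `c i`
  -- is a sign, so the product in the second equation is `±1`.
  set c : Fin n → K := fun i => if π i < i then h q a (e i) else 1 with hc
  have hc1 : ∀ i, c i * c (π i) = h q a (e i) := fun i => by
    simp only [hc, hππ, hinv]
    rcases lt_trichotomy i (π i) with h | h | h
    · simp [h, h.not_gt]
    · rw [if_neg h.ge.not_gt, if_neg h.le.not_gt, hfix i h.symm, one_mul]
    · simp [h, h.not_gt]
  have hcsq : ∀ i, c i ^ 2 = 1 := fun i => by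
    simp only [hc]
    split_ifs
    · rcases hh i with h | h <;> rw [h] <;> simp
    · simp
  have hE : permCoeff q π (top a) * ∏ i, c i ^ (a i - 1) = 1 ∨
      permCoeff q π (top a) * ∏ i, c i ^ (a i - 1) = -1 := by
    rw [← sq_eq_one_iff, mul_pow, permCoeff_top_sq hqq hcomp h2, one_mul, ← Finset.prod_pow]
    exact Finset.prod_eq_one fun i _ => by rw [pow_right_comm, hcsq, one_pow]
  rcases hE with hE | hE
  · exact ⟨c, hc1, hE⟩
  by_cases hI1 : I₁ q a π = ∅
  · have h1 := permCoeff_mul_prod_scalars hi ha hq hqq hcomp h2 hh hI1 hc1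
    have h3 : Even ((J₃ q a π).ncard / 2) := hI.resolve_left (by simp [hI1])
    rw [h3.neg_one_pow] at h1
    exact ⟨c, hc1, h1⟩
  · obtain ⟨k, hk, hk1, hk2⟩ := Set.nonempty_iff_ne_empty.2 hI1
    -- Flipping the sign at `k ∈ I_1` keeps `c k ^ 2`, but negates `c k ^ (a k - 1)` because `a k`
    -- is even.
    refine ⟨fun i => (if i = k then -1 else 1) * c i, fun i => ?_, ?_⟩
    · have : π i = k ↔ i = k := by
        constructor
        · intro h; rw [← hππ i, h, hk]
        · rintro rfl; exact hk
      simp only [this]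
      split_ifs <;> simp [hc1]
    · simp only [mul_pow, Finset.prod_mul_distrib]
      rw [Finset.prod_eq_single k, if_pos rfl, mul_left_comm, hE]
      · rw [Odd.neg_one_pow (Nat.Even.sub_odd (by have := ha k; omega) hk2 odd_one)]
        ring
      · intro b _ hb
        simp [hb]
      · simp

end Scalars

/-! ### The functional `x_{a-1}^*` and its Nakayama automorphism. -/

section Duality

variable {K : Type*} [Field K] {n : ℕ} {q : Matrix (Fin n) (Fin n) K} {a : Fin n → ℕ}
  {π : Equiv.Perm (Fin n)}

theorem top_mem_V : top a ∈ V a := mem_V_iff_le.2 le_rfl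

theorem zero_mem_V : (0 : Fin n → ℕ) ∈ V a := mem_V_iff_le.2 fun _ => Nat.zero_le _

theorem single_mem_V (ha : ∀ i, 2 ≤ a i) (i : Fin n) : (Pi.single i 1 : Fin n → ℕ) ∈ V a :=
  (mem_V ha).2 fun j => by
    rcases eq_or_ne j i with rfl | h
    · have := ha j; simp; omega
    · have := ha j; simp [h]; omega

theorem top_sub_mem_V (v : Fin n → ℕ) : top a - v ∈ V a := mem_V_iff_le.2 tsub_le_self

theorem exists_eq_add_single {v : Fin n → ℕ} (hv : v ≠ 0) : ∃ (w : Fin n → ℕ) (i : Fin n), v = w + Pi.single i 1 := by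
  obtain ⟨i, hi⟩ := Function.ne_iff.1 hv
  have hi' : v i ≠ 0 := hi
  refine ⟨v - Pi.single i 1, i, ?_⟩
  ext j
  rcases eq_or_ne j i with rfl | hj
  · simp; omega
  · simp [hj]

theorem add_top_notMem_V {v : Fin n → ℕ} (hv : v ≠ 0) : v + top a ∉ V a := by
  obtain ⟨i, hi⟩ := Function.ne_iff.1 hv
  have hi' : v i ≠ 0 := hi
  intro h
  have := mem_V_iff_le.1 h i
  simp at this
  exact hi' this

theorem add_top_sub_eq_iff {u v : Fin n → ℕ} (hv : v ∈ V a) : u + (top a - v) = top a ↔ u = v := by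
  have hv' := mem_V_iff_le.1 hv
  constructor
  · intro h
    ext i
    have h1 := congrFun h i
    have h2 : v i ≤ top a i := hv' i
    simp only [Pi.add_apply, Pi.sub_apply] at h1
    omega
  · rintro rfl
    exact add_tsub_cancel_of_le hv'

theorem alg_induction {P : Alg q a → Prop} (hr : ∀ r : K, P (algebraMap K _ r))
    (hx : ∀ i, P (x q a i)) (hmul : ∀ y z, P y → P z → P (y * z))
    (hadd : ∀ y z, P y → P z → P (y + z)) (y : Alg q a) : P y := by
  obtain ⟨y, rfl⟩ := RingQuot.mkAlgHom_surjective K (Rel q a) y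
  induction y with
  | grade0 r => rw [AlgHom.commutes]; exact hr r
  | grade1 i => exact hx i
  | mul y z hy hz => rw [map_mul]; exact hmul _ _ hy hz
  | add y z hy hz => rw [map_add]; exact hadd _ _ hy hz

/-- The diagonal endomorphism `x_i ↦ d_i x_i`. -/
noncomputable def scale (q : Matrix (Fin n) (Fin n) K) (a : Fin n → ℕ)
    (d : Fin n → K) : Alg q a →ₐ[K] Alg q a :=
  RingQuot.liftAlgHom K ⟨FreeAlgebra.lift K fun i => d i • x q a i, by
    intro y z hr
    induction hr with
    | pow i =>
      simp only [map_pow, FreeAlgebra.lift_ι_apply, map_zero, smul_pow, x_pow, smul_zero]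
    | comm i j =>
      simp only [map_mul, FreeAlgebra.lift_ι_apply, map_smul, smul_mul_smul_comm]
      rw [x_mul_x, smul_comm, mul_comm]⟩

theorem scale_x (d : Fin n → K) (i : Fin n) : scale q a d (x q a i) = d i • x q a i := by
  simp [scale, x]

variable (ha : ∀ i, 2 ≤ a i) (hq : ∀ i, q i i = 1) (hqq : ∀ i j, q i j * q j i = 1)

include ha hq hqq

theorem coord_mon (w : {v // v ∈ V a}) (v : Fin n → ℕ) :
    (monBasis ha hq hqq).coord w (mon q a v) = if v = w then 1 else 0 := by
  by_cases hv : v ∈ V a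
  · rw [← monBasis_apply ha hq hqq ⟨v, hv⟩, Module.Basis.coord_apply, Module.Basis.repr_self,
      Finsupp.single_apply]
    simp only [Subtype.ext_iff]
  · rw [mon_eq_zero ha hv, map_zero, if_neg]
    rintro rfl
    exact hv w.2

theorem isTopDual_coord : IsTopDual q a ((monBasis ha hq hqq).coord ⟨top a, top_mem_V⟩) :=
  fun v _ => coord_mon ha hq hqq ⟨top a, top_mem_V⟩ v

theorem eq_of_smul_mon_eq {u v : Fin n → ℕ} (hv : v ∈ V a) {r s : K} (hs : s ≠ 0)
    (huv : r • mon q a u = s • mon q a v) : u = v := by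
  have := congrArg ((monBasis ha hq hqq).coord ⟨v, hv⟩) huv
  simp only [map_smul, coord_mon, smul_eq_mul] at this
  by_contra h
  simp [h, hs.symm] at this

theorem mon_ne_zero {v : Fin n → ℕ} (hv : v ∈ V a) : mon q a v ≠ 0 := by
  rw [← monBasis_apply ha hq hqq ⟨v, hv⟩]
  exact (monBasis ha hq hqq).ne_zero _

theorem x_mul_x_ne_zero {i j : Fin n} (hij : i ≠ j) : x q a i * x q a j ≠ 0 := by
  rw [← mon_single, ← mon_single, mon_mul_mon (entry_ne_zero hqq)]
  refine smul_ne_zero (coeff_ne_zero (entry_ne_zero hqq) _ _) (mon_ne_zero ha hq hqq ?_)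
  refine (mem_V ha).2 fun k => ?_
  have := ha k
  simp only [Pi.add_apply, Pi.single_apply]
  split_ifs with h1 h2
  · exact absurd (h1.symm.trans h2) hij
  all_goals omega

theorem x_pow_ne_zero {i : Fin n} {m : ℕ} (hm : m < a i) : x q a i ^ m ≠ 0 := by
  have h0 := entry_ne_zero hqq
  have key : ∀ m : ℕ, ∃ r : K, r ≠ 0 ∧ x q a i ^ m = r • mon q a (m • Pi.single i 1) := fun m => by
    induction m with
    | zero => exact ⟨1, one_ne_zero, by simp⟩
    | succ m ih =>
      obtain ⟨r, hr, h⟩ := ih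
      refine ⟨r * natCoeff q (Pi.single i 1) (m • Pi.single i 1),
        mul_ne_zero hr (coeff_ne_zero h0 _ _), ?_⟩
      rw [pow_succ', h, mul_smul_comm, x_mul_mon, smul_smul, succ_nsmul]
  obtain ⟨r, hr, h⟩ := key m
  rw [h]
  refine smul_ne_zero hr (mon_ne_zero ha hq hqq ((mem_V ha).2 fun k => ?_))
  have := ha k
  rcases eq_or_ne k i with rfl | hk
  · simpa using hm
  · simp [hk]; omega

theorem x_pow_eq_zero_iff {i : Fin n} {m : ℕ} : x q a i ^ m = 0 ↔ a i ≤ m := by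
  refine ⟨fun h => not_lt.1 fun hm => x_pow_ne_zero ha hq hqq hm h, fun h => ?_⟩
  rw [← Nat.add_sub_cancel' h, pow_add, x_pow, zero_mul]

section TopDual

variable {φ : Module.Dual K (Alg q a)} (hφ : IsTopDual q a φ)

include hφ

omit hq hqq in
theorem topDual_mon (v : Fin n → ℕ) : φ (mon q a v) = if v = top a then 1 else 0 := by
  by_cases hv : v ∈ V a
  · exact hφ v hv
  · rw [mon_eq_zero ha hv, map_zero, if_neg]
    rintro rfl
    exact hv top_mem_V

/-- Among the basis monomials only `x_v` times `x_{a-1-v}` reaches the top degree, so this product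
reads off one coordinate. Nondegeneracy of `φ` follows. -/
theorem topDual_mul_mon (v : {v // v ∈ V a}) (y : Alg q a) :
    φ (y * mon q a (top a - v)) = natCoeff q v (top a - v) * (monBasis ha hq hqq).coord v y := by
  suffices h : φ ∘ₗ LinearMap.mulRight K (mon q a (top a - v)) =
      natCoeff q v (top a - v) • (monBasis ha hq hqq).coord v from LinearMap.congr_fun h y
  refine (monBasis ha hq hqq).ext fun u => ?_
  rw [monBasis_apply, LinearMap.smul_apply, coord_mon, LinearMap.comp_apply,
    LinearMap.mulRight_apply, mon_mul_mon (entry_ne_zero hqq), map_smul, topDual_mon ha hφ]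
  simp only [add_top_sub_eq_iff v.2]
  split_ifs with h
  · rw [h]
  · simp

theorem topDual_mon_mul (v : {v // v ∈ V a}) (y : Alg q a) :
    φ (mon q a (top a - v) * y) = natCoeff q (top a - v) v * (monBasis ha hq hqq).coord v y := by
  suffices h : φ ∘ₗ LinearMap.mulLeft K (mon q a (top a - v)) =
      natCoeff q (top a - v) v • (monBasis ha hq hqq).coord v from LinearMap.congr_fun h y
  refine (monBasis ha hq hqq).ext fun u => ?_
  rw [monBasis_apply, LinearMap.smul_apply, coord_mon, LinearMap.comp_apply,
    LinearMap.mulLeft_apply, mon_mul_mon (entry_ne_zero hqq), map_smul, topDual_mon ha hφ, add_comm]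
  simp only [add_top_sub_eq_iff v.2]
  split_ifs with h
  · rw [h]
  · simp

theorem eq_of_forall_topDual_mul {y z : Alg q a} (hyz : ∀ w, φ (w * y) = φ (w * z)) : y = z := by
  refine (monBasis ha hq hqq).ext_elem fun v => ?_
  have := hyz (mon q a (top a - v))
  rw [topDual_mon_mul ha hq hqq hφ, topDual_mon_mul ha hq hqq hφ] at this
  exact mul_left_cancel₀ (coeff_ne_zero (entry_ne_zero hqq) _ _) this

/-- Both sides vanish on basis monomials other than `x_{a-1-e_i}`, where `h` is by definition the
ratio of the two structure constants. Thus `𝒩` acts on `x_i` by the inverse of `h_{e_i}`. -/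
theorem h_mul_topDual_x_mul (i : Fin n) (y : Alg q a) :
    h q a (e i) * φ (x q a i * y) = φ (y * x q a i) := by
  have h0 := entry_ne_zero hqq
  suffices hs : h q a (e i) • (φ ∘ₗ LinearMap.mulLeft K (x q a i)) =
      φ ∘ₗ LinearMap.mulRight K (x q a i) from LinearMap.congr_fun hs y
  refine (monBasis ha hq hqq).ext fun u => ?_
  rw [monBasis_apply, LinearMap.smul_apply, LinearMap.comp_apply, LinearMap.comp_apply,
    LinearMap.mulRight_apply, LinearMap.mulLeft_apply, ← mon_single, mon_mul_mon h0,
    mon_mul_mon h0, map_smul, map_smul, topDual_mon ha hφ, topDual_mon ha hφ,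
    add_comm (Pi.single i 1)]
  split_ifs with h1
  · have hu : (u : Fin n → ℕ) = top a - Pi.single i 1 := by rw [← h1, add_tsub_cancel_right]
    rw [← cast_single, h_eq_natCoeff (single_mem_V ha i) ha, hu]
    simp only [smul_eq_mul, mul_one]
    exact div_mul_cancel₀ _ (coeff_ne_zero h0 _ _)
  · simp

end TopDual

theorem h_sq_of_nakayama (hN : NakayamaSqEqId q a) (i : Fin n) :
    h q a (e i) = 1 ∨ h q a (e i) = -1 := by
  obtain ⟨N, ⟨φ, hφ, hN⟩, hN2⟩ := hN
  have h0 : h q a (e i) ≠ 0 := h_ne_zero (entry_ne_zero hqq) _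
  have hx : h q a (e i) • N (x q a i) = x q a i := by
    refine eq_of_forall_topDual_mul ha hq hqq hφ fun w => ?_
    rw [mul_smul_comm, map_smul, ← hN, smul_eq_mul, h_mul_topDual_x_mul ha hq hqq hφ]
  have hx2 : h q a (e i) ^ 2 • x q a i = x q a i := by
    conv_rhs => rw [← hx, ← hx, map_smul, hN2, smul_smul, ← sq]
  rw [← sq_eq_one_iff]
  have hx0 : x q a i ≠ 0 := by
    rw [← mon_single]; exact mon_ne_zero ha hq hqq (single_mem_V ha i)
  exact smul_left_injective K hx0 (hx2.trans (one_smul K _).symm)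

/-- Since each `h_{e_i}` is its own inverse, `𝒩` is the scaling by `h_{e_i}` itself. Its defining
identity is closed under products in the first argument, so generators suffice. -/
theorem nakayamaSqEqId_of_h_sq (hh : ∀ i, h q a (e i) = 1 ∨ h q a (e i) = -1) :
    NakayamaSqEqId q a := by
  have hsq : ∀ i, h q a (e i) * h q a (e i) = 1 := fun i => by
    rcases hh i with h | h <;> rw [h] <;> simp
  set D := scale q a fun i => h q a (e i) with hD
  have hDD : ∀ y, D (D y) = y := fun y => by
    induction y using alg_induction with
    | hr r => rw [AlgHom.commutes, AlgHom.commutes]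
    | hx i => rw [hD, scale_x, map_smul, scale_x, smul_smul, hsq, one_smul]
    | hmul y z hy hz => rw [map_mul, map_mul, hy, hz]
    | hadd y z hy hz => rw [map_add, map_add, hy, hz]
  have hφ := isTopDual_coord ha hq hqq
  refine ⟨AlgEquiv.ofAlgHom D D (AlgHom.ext hDD) (AlgHom.ext hDD), ⟨_, hφ, fun y => ?_⟩, hDD⟩
  change ∀ z, _ = (monBasis ha hq hqq).coord ⟨top a, top_mem_V⟩ (z * D y)
  induction y using alg_induction with
  | hr r => intro z; rw [AlgHom.commutes, Algebra.commutes]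
  | hx i =>
    intro z
    rw [hD, scale_x, mul_smul_comm, map_smul, ← h_mul_topDual_x_mul ha hq hqq hφ, smul_eq_mul,
      ← mul_assoc, hsq, one_mul]
  | hmul y y' hy hy' =>
    intro z
    rw [mul_assoc, hy, mul_assoc, hy', map_mul D, mul_assoc]
  | hadd y y' hy hy' =>
    intro z
    rw [add_mul, map_add, hy, hy', map_add, mul_add, map_add]

end Duality

/-! ### Necessity: what a permutation antipode forces. -/

section PermutationAntipode

variable {K : Type*} [Field K] {n : ℕ} {q : Matrix (Fin n) (Fin n) K} {a : Fin n → ℕ}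
  {π : Equiv.Perm (Fin n)}
  (ha : ∀ i, 2 ≤ a i) (hq : ∀ i, q i i = 1) (hqq : ∀ i j, q i j * q j i = 1)

include ha hq hqq

/-- An anti-automorphism permuting the standard basis up to scalars permutes the generators. -/
theorem exists_perm_of_permutation_antihom {S : Alg q a →ₗ[K] Alg q a}
    (S_inj : Function.Injective S) (S_one : S 1 = 1) (S_mul : ∀ y z, S (y * z) = S z * S y)
    (σ : Equiv.Perm {v // v ∈ V a}) (d : {v // v ∈ V a} → K)
    (hS : ∀ v : {v // v ∈ V a}, S (mon q a v) = d v • mon q a (σ v)) :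
    ∃ (π : Equiv.Perm (Fin n)) (c : Fin n → K),
      (∀ i, c i ≠ 0) ∧ ∀ i, S (x q a i) = c i • x q a (π i) := by
  have h0 := entry_ne_zero hqq
  have hd : ∀ v, d v ≠ 0 := fun v hv => by
    have h1 := hS v
    rw [hv, zero_smul] at h1
    exact mon_ne_zero ha hq hqq v.2 (S_inj (h1.trans (map_zero S).symm))
  have hσ0 : (σ ⟨0, zero_mem_V⟩ : Fin n → ℕ) = 0 := by
    refine eq_of_smul_mon_eq ha hq hqq zero_mem_V (r := d ⟨0, zero_mem_V⟩) one_ne_zero ?_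
    rw [← hS]
    simp [S_one]
  let E : Fin n → {v // v ∈ V a} := fun i => ⟨Pi.single i 1, single_mem_V ha i⟩
  have hE : Function.Injective E := fun i j hij => by
    have h1 := congrFun (congrArg Subtype.val hij) i
    by_contra hne
    simp [E, hne] at h1
  -- If `σ w = e_i` and `w = w' + e_j`, antimultiplicativity gives `σ(e_j) + σ(w') = e_i`. As
  -- `σ(e_j) ≠ 0`, the indecomposability of `e_i` gives `σ(e_j) = e_i`.
  have key : ∀ i, ∃ j, σ (E j) = E i := fun i => by
    obtain ⟨w, hw⟩ := σ.surjective (E i)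
    have hw0 : (w : Fin n → ℕ) ≠ 0 := fun h => by
      have h1 : w = ⟨0, zero_mem_V⟩ := Subtype.ext h
      rw [h1] at hw
      rw [hw] at hσ0
      have := congrFun hσ0 i
      simp [E] at this
    obtain ⟨w', j, hj⟩ := exists_eq_add_single hw0
    have hw' : w' ∈ V a := by
      have h1 := w.2
      rw [hj, mem_V_iff_le] at h1
      exact mem_V_iff_le.2 (le_trans le_self_add h1)
    have h1 := mon_mul_mon h0 (a := a) w' (Pi.single j 1)
    rw [← hj] at h1
    have h2 := congrArg S h1
    rw [S_mul, map_smul, hS w, hS ⟨w', hw'⟩, hS (E j), hw, smul_mul_smul_comm, mon_mul_mon h0,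
      smul_smul, smul_smul] at h2
    have h3 := eq_of_smul_mon_eq ha hq hqq (E i).2
      (mul_ne_zero (coeff_ne_zero h0 _ _) (hd w)) h2
    refine ⟨j, ?_⟩
    have hne : (σ (E j) : Fin n → ℕ) ≠ 0 := fun h => by
      have h4 : σ (E j) = σ ⟨0, zero_mem_V⟩ := Subtype.ext (h.trans hσ0.symm)
      have := congrFun (congrArg Subtype.val (σ.injective h4)) j
      simp [E] at this
    obtain ⟨k, hk⟩ := Function.ne_iff.1 hne
    have hle : ∀ l, (σ (E j) : Fin n → ℕ) l ≤ (Pi.single i 1 : Fin n → ℕ) l := fun l => by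
      have h5 := congrFun h3 l
      simp only [E, Pi.add_apply] at h5 ⊢
      omega
    have hk0 : (σ (E j) : Fin n → ℕ) k ≠ 0 := hk
    have hki : k = i := by
      by_contra hki
      have := hle k
      rw [Pi.single_eq_of_ne hki] at this
      omega
    subst hki
    refine Subtype.ext (funext fun l => ?_)
    change (σ (E j) : Fin n → ℕ) l = (Pi.single k 1 : Fin n → ℕ) l
    have := hle l
    rcases eq_or_ne l k with rfl | hl
    · rw [Pi.single_eq_same] at this ⊢
      omega
    · rw [Pi.single_eq_of_ne hl] at this ⊢
      omega
  choose p hp using key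
  have hpinj : Function.Injective p := fun i j hij => hE (by rw [← hp i, ← hp j, hij])
  let P := Equiv.ofBijective p (Finite.injective_iff_bijective.1 hpinj)
  refine ⟨P.symm, fun i => d (E i), fun i => hd _, fun i => ?_⟩
  have h1 := hp (P.symm i)
  have h2 : p (P.symm i) = i := P.apply_symm_apply i
  rw [h2] at h1
  rw [← mon_single, ← mon_single]
  change S (mon q a (E i)) = _
  rw [hS, h1]

/-- `S` preserves the nilpotency index of a generator, which is `a i`, and reverses the commutation
relations. -/
theorem compatible_of_antihom {S : Alg q a →ₗ[K] Alg q a}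
    (S_inj : Function.Injective S) (S_one : S 1 = 1) (S_mul : ∀ y z, S (y * z) = S z * S y)
    {c : Fin n → K} (hc : ∀ i, c i ≠ 0) (hS : ∀ i, S (x q a i) = c i • x q a (π i)) :
    Compatible q a π := by
  constructor
  · intro i
    have hpow : ∀ m : ℕ, S (x q a i ^ m) = c i ^ m • x q a (π i) ^ m := fun m => by
      induction m with
      | zero => simp [S_one]
      | succ m ih => rw [pow_succ, S_mul, ih, hS, smul_mul_smul_comm, ← pow_succ', ← pow_succ']
    have hiff : ∀ m, a (π i) ≤ m ↔ a i ≤ m := fun m => by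
      rw [← x_pow_eq_zero_iff ha hq hqq, ← x_pow_eq_zero_iff ha hq hqq (i := i),
        ← map_eq_zero_iff S S_inj (x := x q a i ^ m), hpow, smul_eq_zero_iff_right (pow_ne_zero _ (hc i))]
    exact le_antisymm ((hiff _).2 le_rfl) ((hiff _).1 le_rfl)
  · intro j i
    rcases eq_or_ne i j with rfl | hij
    · rw [hq, hq]
    have h1 := congrArg S (x_mul_x (q := q) (a := a) i j)
    rw [S_mul, map_smul, S_mul, hS, hS, smul_mul_smul_comm, smul_mul_smul_comm,
      x_mul_x (π j) (π i), smul_smul, smul_smul] at h1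
    have h2 := smul_left_injective K
      (x_mul_x_ne_zero ha hq hqq fun h => hij (π.injective h).symm) h1
    have h3 : (c i * c j) * q (π j) (π i) = (c i * c j) * q i j := by
      rw [h2]; ring
    exact mul_left_cancel₀ (mul_ne_zero (hc i) (hc j)) h3

omit hq in
theorem counit_mon_of_ne_zero (B : BiFrobeniusStructure K (Alg q a)) {v : Fin n → ℕ}
    (hv : v ≠ 0) : B.counit (mon q a v) = 0 := by
  let ε : Alg q a →* K := ⟨⟨B.counit, B.counit_one⟩, B.counit_mul⟩
  obtain ⟨w, i, rfl⟩ := exists_eq_add_single hv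
  have hx : B.counit (x q a i) = 0 := by
    have h1 : ε (x q a i) ^ a i = 0 := by
      rw [← map_pow, x_pow]
      exact map_zero B.counit
    exact (pow_eq_zero_iff (by have := ha i; omega)).1 h1
  rw [mon_add_single (entry_ne_zero hqq), map_smul, B.counit_mul, hx, zero_mul, smul_zero]

/-- For `v ≠ a-1` the integral `t` annihilates `x_{a-1-v}`, and that product detects the coordinate
of `t` at `v`. -/
theorem t_eq_smul_mon_top (B : BiFrobeniusStructure K (Alg q a)) :
    ∃ r : K, B.t = r • mon q a (top a) := by
  refine ⟨(monBasis ha hq hqq).coord ⟨top a, top_mem_V⟩ B.t,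
    (monBasis ha hq hqq).ext_elem fun v => ?_⟩
  change (monBasis ha hq hqq).coord v _ = (monBasis ha hq hqq).coord v _
  rw [map_smul, coord_mon]
  split_ifs with h
  · have hv : v = ⟨top a, top_mem_V⟩ := Subtype.ext h.symm
    rw [hv]
    simp
  · have h1 := topDual_mul_mon ha hq hqq (isTopDual_coord ha hq hqq) v B.t
    have h2 : top a - v ≠ 0 := fun h2 => h (le_antisymm (tsub_eq_zero_iff_le.1 h2)
      (mem_V_iff_le.1 v.2))
    rw [B.t_mul, counit_mon_of_ne_zero ha hqq B h2, zero_smul, map_zero] at h1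
    rw [smul_zero]
    exact ((mul_eq_zero.1 h1.symm).resolve_left (coeff_ne_zero (entry_ne_zero hqq) _ _))

theorem mul_t (B : BiFrobeniusStructure K (Alg q a)) (y : Alg q a) :
    y * B.t = B.counit y • B.t := by
  suffices h : LinearMap.mulRight K B.t = B.counit.smulRight B.t from LinearMap.congr_fun h y
  refine (monBasis ha hq hqq).ext fun v => ?_
  rw [monBasis_apply, LinearMap.mulRight_apply, LinearMap.smulRight_apply]
  by_cases hv : (v : Fin n → ℕ) = 0
  · rw [hv, mon_zero, B.counit_one, one_mul, one_smul]
  · obtain ⟨r, hr⟩ := t_eq_smul_mon_top ha hq hqq B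
    rw [counit_mon_of_ne_zero ha hqq B hv, zero_smul, hr, mul_smul_comm,
      mon_mul_mon (entry_ne_zero hqq), mon_eq_zero ha (add_top_notMem_V hv), smul_zero, smul_zero]

/-- `B.φ` need not be `x_{a-1}^*`; only its nonvanishing on `x_{a-1}` enters. -/
theorem scalarEquations_of_biFrobenius (B : BiFrobeniusStructure K (Alg q a)) {c : Fin n → K}
    (hπ : Compatible q a π) (hS : ∀ i, B.S (x q a i) = c i • x q a (π i)) :
    π ^ 2 = 1 ∧ ScalarEquations q a π c := by
  have h0 := entry_ne_zero hqq
  have ht := mul_t ha hq hqq B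
  obtain ⟨r, hr⟩ := t_eq_smul_mon_top ha hq hqq B
  have hrφ : r * B.φ (mon q a (top a)) = 1 := by
    rw [← smul_eq_mul, ← map_smul, ← hr, B.φ_t]
  have hr0 : r ≠ 0 := left_ne_zero_of_mul_eq_one hrφ
  have hφ0 : B.φ (mon q a (top a)) ≠ 0 := right_ne_zero_of_mul_eq_one hrφ
  have hsub : ∀ i, top a - Pi.single i 1 + Pi.single i 1 = top a := fun i =>
    tsub_add_cancel_of_le (mem_V_iff_le.1 (single_mem_V ha i))
  have hSS : ∀ i, c i * c (π i) * B.φ (x q a (π (π i)) * mon q a (top a - Pi.single i 1)) =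
      natCoeff q (top a - Pi.single i 1) (Pi.single i 1) * B.φ (mon q a (top a)) := fun i => by
    have h1 := B.φ_S_S_mul ht (x q a i) (mon q a (top a - Pi.single i 1))
    rw [hS, map_smul, hS, smul_smul, smul_mul_assoc, map_smul, smul_eq_mul] at h1
    rw [h1]
    conv_lhs => rw [← mon_single i, mon_mul_mon h0, hsub, map_smul, smul_eq_mul]
  -- Otherwise `x_{π²(i)} x_{a-1-e_i}` leaves `V` and is zero, while the other side of `hSS` is not.
  have hππ : ∀ i, π (π i) = i := fun i => by
    by_contra hne
    have h1 := hSS i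
    have hnot : top a - Pi.single i 1 + Pi.single (π (π i)) 1 ∉ V a := fun hmem => by
      have h2 := mem_V_iff_le.1 hmem (π (π i))
      simp [hne] at h2
    rw [x_mul_mon, mon_eq_zero ha hnot, smul_zero, map_zero, mul_zero] at h1
    exact mul_ne_zero (coeff_ne_zero h0 _ _) hφ0 h1.symm
  refine ⟨Equiv.ext fun i => by rw [sq, Equiv.Perm.mul_apply, hππ]; rfl, fun i => ?_, ?_⟩
  · have h1 := hSS i
    rw [hππ, x_mul_mon, hsub, map_smul, smul_eq_mul, ← mul_assoc] at h1
    rw [← cast_single, h_eq_natCoeff (single_mem_V ha i) ha,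
      eq_div_iff (coeff_ne_zero h0 _ _)]
    exact mul_right_cancel₀ hφ0 h1
  · have h1 := B.S_t ht
    rw [hr, map_smul] at h1
    have h2 := smul_right_injective _ hr0 h1
    rw [antihom_mon hq hqq hπ.2 B.S B.S_one B.S_mul hS, act_top hπ.1] at h2
    have h3 := smul_left_injective K (mon_ne_zero ha hq hqq top_mem_V)
      (h2.trans (one_smul K _).symm)
    rw [mul_comm]
    exact h3

theorem good_of_permutationAntipode (hi : ∀ z : K, z ^ 2 ≠ -1)
    (B : BiFrobeniusStructure K (Alg q a)) (hB : IsPermutationAntipode B) :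
    NakayamaSqEqId q a ∧ ∃ π, GoodInvolution q a π := by
  obtain ⟨σ, d, hσ⟩ := hB
  obtain ⟨π, c, hc, hS⟩ := exists_perm_of_permutation_antihom ha hq hqq B.S_injective B.S_one
    B.S_mul σ d hσ
  have hπ := compatible_of_antihom ha hq hqq B.S_injective B.S_one B.S_mul hc hS
  obtain ⟨h2, hE⟩ := scalarEquations_of_biFrobenius ha hq hqq B hπ hS
  have hh : ∀ i, h q a (e i) = 1 ∨ h q a (e i) = -1 := fun i => by
    rw [← sq_eq_one_iff, sq]
    have h1 : h q a (e (π i)) = h q a (e i) := by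
      rw [← hE.1, ← hE.1, apply_apply_of_sq h2, mul_comm]
    nth_rewrite 1 [← h1]
    rw [h_e_perm hq hqq hπ, inv_mul_cancel₀ (h_ne_zero (entry_ne_zero hqq) _)]
  exact ⟨nakayamaSqEqId_of_h_sq ha hq hqq hh, π,
    goodInvolution_of_scalarEquations hi ha hq hqq hπ h2 hh hE⟩

end PermutationAntipode

/-! ### Sufficiency: the explicit bi-Frobenius structure. -/

section Explicit

variable {K : Type*} [Field K] {n : ℕ} {q : Matrix (Fin n) (Fin n) K} {a : Fin n → ℕ}
  {π : Equiv.Perm (Fin n)} {c : Fin n → K}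

/-- The augmentation `x_i ↦ 0`. -/
noncomputable def augmentation (q : Matrix (Fin n) (Fin n) K) {a : Fin n → ℕ}
    (ha : ∀ i, 2 ≤ a i) : Alg q a →ₐ[K] K :=
  RingQuot.liftAlgHom K ⟨FreeAlgebra.lift K fun _ => 0, by
    intro y z hr
    induction hr with
    | pow i =>
      simp only [map_pow, FreeAlgebra.lift_ι_apply, map_zero]
      exact zero_pow (by have := ha i; omega)
    | comm i j => simp⟩

theorem augmentation_x (ha : ∀ i, 2 ≤ a i) (i : Fin n) : augmentation q ha (x q a i) = 0 := by
  simp [augmentation, x]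

theorem augmentation_mon (ha : ∀ i, 2 ≤ a i) (hq : ∀ i j, q i j ≠ 0) (v : Fin n → ℕ) :
    augmentation q ha (mon q a v) = if v = 0 then 1 else 0 := by
  split_ifs with hv
  · rw [hv, mon_zero, map_one]
  · obtain ⟨w, i, rfl⟩ := exists_eq_add_single hv
    rw [mon_add_single hq, map_smul, map_mul, augmentation_x, zero_mul, smul_zero]

/-- The anti-endomorphism `x_i ↦ c_i x_{π(i)}`, as a homomorphism to the opposite algebra. -/
noncomputable def antipodeHom (hπ : Compatible q a π) (c : Fin n → K) :
    Alg q a →ₐ[K] (Alg q a)ᵐᵒᵖ :=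
  RingQuot.liftAlgHom K ⟨FreeAlgebra.lift K fun i => MulOpposite.op (c i • x q a (π i)), by
    intro y z hr
    induction hr with
    | pow i =>
      simp only [map_pow, FreeAlgebra.lift_ι_apply, map_zero]
      rw [← MulOpposite.op_pow, smul_pow, ← hπ.1, x_pow, smul_zero, MulOpposite.op_zero]
    | comm i j =>
      simp only [map_mul, FreeAlgebra.lift_ι_apply, map_smul]
      rw [← MulOpposite.op_mul, ← MulOpposite.op_mul, ← MulOpposite.op_smul,
        smul_mul_smul_comm, smul_mul_smul_comm, x_mul_x (π j) (π i), hπ.2, mul_comm (c j),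
        smul_comm]⟩

/-- The linear anti-endomorphism with `x_i ↦ c_i x_{π(i)}`. -/
noncomputable def antipode (hπ : Compatible q a π) (c : Fin n → K) : Alg q a →ₗ[K] Alg q a :=
  (MulOpposite.opLinearEquiv K).symm.toLinearMap ∘ₗ (antipodeHom hπ c).toLinearMap

theorem antipode_x (hπ : Compatible q a π) (i : Fin n) :
    antipode hπ c (x q a i) = c i • x q a (π i) := by
  simp [antipode, antipodeHom, x]

theorem antipode_one (hπ : Compatible q a π) : antipode hπ c 1 = 1 := by
  simp [antipode]

theorem antipode_mul (hπ : Compatible q a π) (y z : Alg q a) :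
    antipode hπ c (y * z) = antipode hπ c z * antipode hπ c y := by
  simp [antipode]

theorem augmentation_antipode (ha : ∀ i, 2 ≤ a i) (hπ : Compatible q a π) (y : Alg q a) :
    augmentation q ha (antipode hπ c y) = augmentation q ha y := by
  induction y using alg_induction with
  | hr r => rw [Algebra.algebraMap_eq_smul_one, map_smul, antipode_one]
  | hx i => rw [antipode_x, map_smul, augmentation_x, augmentation_x, smul_zero]
  | hmul y z hy hz => rw [antipode_mul, map_mul, map_mul, hy, hz, mul_comm]
  | hadd y z hy hz => rw [map_add, map_add, map_add, hy, hz]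

theorem scale_mon (hq : ∀ i j, q i j ≠ 0) (d : Fin n → K) (v : Fin n → ℕ) :
    scale q a d (mon q a v) = (∏ i, d i ^ v i) • mon q a v := by
  induction v using vec_induction with
  | h0 => simp
  | hs v i ih =>
    have hd : (∏ j, d j ^ (v + Pi.single i 1 : Fin n → ℕ) j) = (∏ j, d j ^ v j) * d i := by
      simp only [Pi.add_apply, pow_add, Finset.prod_mul_distrib]
      congr 1
      rw [Finset.prod_eq_single i]
      · simp
      · intro b _ hb
        simp [hb]
      · simp
    rw [mon_add_single hq, map_smul, map_mul, ih, scale_x, smul_mul_smul_comm, hd,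
      mul_comm (d i), smul_comm]

/-- The coefficient of `S(x_v)`. -/
noncomputable abbrev antipodeCoeff (q : Matrix (Fin n) (Fin n) K) (π : Equiv.Perm (Fin n))
    (c : Fin n → K) (v : Fin n → ℕ) : K :=
  (∏ i, c i ^ v i) * permCoeff q π v

theorem g_eq (ha : ∀ i, 2 ≤ a i) {v : Fin n → ℕ} (hv : v ∈ V a) :
    g q a π c v = (natCoeff q (top a - v) v)⁻¹ * antipodeCoeff q π c v := by
  have : (fun i => (a i : ℤ) - 1 - v i) = fun i => (((top a - v) i : ℕ) : ℤ) := by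
    ext i
    have h1 := (mem_V ha).1 hv i
    simp only [top, Pi.sub_apply]
    omega
  rw [g, this, mul_assoc]

/-- The exponents other than `0` and `a - 1`. -/
def middle (a : Fin n → ℕ) : Finset (Fin n → ℕ) := ((V a).erase (top a)).erase 0

theorem mem_middle {v : Fin n → ℕ} : v ∈ middle a ↔ v ∈ V a ∧ v ≠ 0 ∧ v ≠ top a := by
  simp only [middle, Finset.mem_erase]
  tauto

theorem top_sub_mem_middle {v : Fin n → ℕ} (hv : v ∈ middle a) : top a - v ∈ middle a := by
  rw [mem_middle] at hv ⊢
  have h1 := mem_V_iff_le.1 hv.1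
  refine ⟨top_sub_mem_V v, fun h => hv.2.2 (le_antisymm h1 (tsub_eq_zero_iff_le.1 h)), fun h => ?_⟩
  have := tsub_tsub_cancel_of_le h1
  rw [h, tsub_self] at this
  exact hv.2.1 this.symm

omit [Field K] in
theorem act_mem_middle (hπ : Compatible q a π) (h2 : π ^ 2 = 1) {v : Fin n → ℕ}
    (hv : v ∈ middle a) : act π v ∈ middle a := by
  rw [mem_middle] at hv ⊢
  refine ⟨(act_mem_V hπ.1).2 hv.1, fun h => hv.2.1 ?_, fun h => hv.2.2 ?_⟩
  · rw [← act_act h2 v, h]; rfl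
  · rw [← act_act h2 v, h, act_top hπ.1]

variable (ha : ∀ i, 2 ≤ a i) (hq : ∀ i, q i i = 1) (hqq : ∀ i j, q i j * q j i = 1)

/-- The comultiplication attached to `π` and the scalars `c_i`. -/
noncomputable def explicitComul (π : Equiv.Perm (Fin n)) (c : Fin n → K) :
    Alg q a →ₗ[K] Alg q a ⊗[K] Alg q a :=
  (monBasis ha hq hqq).constr K fun v =>
    if (v : Fin n → ℕ) = 0 then 1 ⊗ₜ[K] 1
    else if (v : Fin n → ℕ) = top a then
      ∑ v ∈ V a, g q a π c v • (mon q a (top a - v) ⊗ₜ[K] mon q a (act π v))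
    else 1 ⊗ₜ[K] mon q a v + mon q a v ⊗ₜ[K] 1

theorem explicitComul_mon {v : Fin n → ℕ} (hv : v ∈ V a) :
    explicitComul ha hq hqq π c (mon q a v) = if v = 0 then 1 ⊗ₜ[K] 1
      else if v = top a then
        ∑ v ∈ V a, g q a π c v • (mon q a (top a - v) ⊗ₜ[K] mon q a (act π v))
      else 1 ⊗ₜ[K] mon q a v + mon q a v ⊗ₜ[K] 1 := by
  rw [← monBasis_apply ha hq hqq ⟨v, hv⟩, explicitComul, Module.Basis.constr_basis]
  simp

theorem explicitComul_one : explicitComul ha hq hqq π c 1 = 1 ⊗ₜ[K] 1 := by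
  rw [← mon_zero, explicitComul_mon ha hq hqq zero_mem_V, if_pos rfl, mon_zero]

theorem explicitComul_middle {v : Fin n → ℕ} (hv : v ∈ middle a) :
    explicitComul ha hq hqq π c (mon q a v) = 1 ⊗ₜ[K] mon q a v + mon q a v ⊗ₜ[K] 1 := by
  rw [mem_middle] at hv
  rw [explicitComul_mon ha hq hqq hv.1, if_neg hv.2.1, if_neg hv.2.2]

/-- For `n = 0` the exponents `0` and `a - 1` coincide, and the first branch of `explicitComul`
would hide the second. -/
theorem top_ne_zero (ha : ∀ i, 2 ≤ a i) (hn : n ≠ 0) : top a ≠ 0 := fun h => by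
  have h1 := congrFun h ⟨0, Nat.pos_of_ne_zero hn⟩
  have h2 := ha ⟨0, Nat.pos_of_ne_zero hn⟩
  simp only [top, Pi.zero_apply] at h1
  omega

theorem explicitComul_top (hn : n ≠ 0) : explicitComul ha hq hqq π c (mon q a (top a)) =
    ∑ v ∈ V a, g q a π c v • (mon q a (top a - v) ⊗ₜ[K] mon q a (act π v)) := by
  rw [explicitComul_mon ha hq hqq top_mem_V, if_neg (top_ne_zero ha hn), if_pos rfl]

/-- The coefficient at `v = a - 1` is `1` precisely by the second scalar equation; this gives the
counit axiom. -/
theorem explicitComul_top_eq_add (hn : n ≠ 0) (hπ : Compatible q a π)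
    (hc : ScalarEquations q a π c) : explicitComul ha hq hqq π c (mon q a (top a)) =
      mon q a (top a) ⊗ₜ[K] 1 + 1 ⊗ₜ[K] mon q a (top a) +
        ∑ v ∈ middle a, g q a π c v • (mon q a (top a - v) ⊗ₜ[K] mon q a (act π v)) := by
  have hg0 : g q a π c 0 = 1 := by
    rw [g_eq ha zero_mem_V, natCoeff_zero_right]
    simp [antipodeCoeff]
  have hgt : g q a π c (top a) = 1 := by
    rw [g_eq ha top_mem_V, tsub_self, natCoeff_zero_left, inv_one, one_mul, antipodeCoeff,
      mul_comm]
    exact hc.2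
  have hact0 : act π (0 : Fin n → ℕ) = 0 := rfl
  rw [explicitComul_top ha hq hqq hn, ← Finset.add_sum_erase _ _ top_mem_V, middle,
    ← Finset.add_sum_erase ((V a).erase (top a)) _
      (Finset.mem_erase.2 ⟨(top_ne_zero ha hn).symm, zero_mem_V⟩), hg0, hgt, tsub_self,
    act_top hπ.1, hact0, mon_zero, tsub_zero, one_smul, one_smul]
  abel

include hq hqq in
theorem antipode_mon (hπ : Compatible q a π) (v : Fin n → ℕ) :
    antipode hπ c (mon q a v) = antipodeCoeff q π c v • mon q a (act π v) :=
  antihom_mon hq hqq hπ.2 _ (antipode_one hπ) (antipode_mul hπ) (antipode_x hπ) v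

include hq hqq in
theorem antipode_mon_top (hπ : Compatible q a π) (hc : ScalarEquations q a π c) :
    antipode hπ c (mon q a (top a)) = mon q a (top a) := by
  have h1 : antipodeCoeff q π c (top a) = 1 := (mul_comm _ _).trans hc.2
  rw [antipode_mon hq hqq, act_top hπ.1, h1, one_smul]

include ha hq hqq in
-- `S²` and the scaling by `h_{e_i}` are multiplicative and agree on generators. Comparing them on
-- `x_v` avoids manipulating `permCoeff`.
theorem antipodeCoeff_mul_act (hπ : Compatible q a π) (h2 : π ^ 2 = 1)
    (hc : ScalarEquations q a π c) {v : Fin n → ℕ} (hv : v ∈ V a) :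
    antipodeCoeff q π c v * antipodeCoeff q π c (act π v) =
      natCoeff q (top a - v) v / natCoeff q v (top a - v) := by
  have h0 := entry_ne_zero hqq
  have hSS : ∀ y, antipode hπ c (antipode hπ c y) = scale q a (fun i => h q a (e i)) y := fun y => by
    induction y using alg_induction with
    | hr r => rw [Algebra.algebraMap_eq_smul_one]; simp [antipode_one]
    | hx i =>
      rw [antipode_x, map_smul, antipode_x, smul_smul, hc.1, apply_apply_of_sq h2, scale_x]
    | hmul y z hy hz => rw [antipode_mul, antipode_mul, map_mul, hy, hz]
    | hadd y z hy hz => rw [map_add, map_add, map_add, hy, hz]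
  have h1 := hSS (mon q a v)
  rw [antipode_mon hq hqq, map_smul, antipode_mon hq hqq, smul_smul, act_act h2, scale_mon h0,
    ← h_natCast h0, h_eq_natCoeff hv ha] at h1
  exact smul_left_injective K (mon_ne_zero ha hq hqq hv) h1

include hqq in
theorem antipodeCoeff_ne_zero (hc : ScalarEquations q a π c) (v : Fin n → ℕ) :
    antipodeCoeff q π c v ≠ 0 := by
  have h0 := entry_ne_zero hqq
  refine mul_ne_zero (Finset.prod_ne_zero_iff.2 fun i _ => pow_ne_zero _ ?_)
    (Finset.prod_ne_zero_iff.2 fun j _ => Finset.prod_ne_zero_iff.2 fun k _ =>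
      pow_ne_zero _ (coeff_ne_zero h0 _ _))
  have h1 := hc.1 i
  exact left_ne_zero_of_mul (h1 ▸ h_ne_zero h0 _)

include ha hq hqq in
theorem antipode_surjective (hπ : Compatible q a π) (h2 : π ^ 2 = 1)
    (hc : ScalarEquations q a π c) : Function.Surjective (antipode hπ c) := by
  rw [← LinearMap.range_eq_top, eq_top_iff, ← span_mon ha, Submodule.span_le]
  rintro _ ⟨v, rfl⟩
  refine ⟨(antipodeCoeff q π c (act π v))⁻¹ • mon q a (act π v), ?_⟩
  rw [map_smul, antipode_mon hq hqq, act_act h2, smul_smul,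
    inv_mul_cancel₀ (antipodeCoeff_ne_zero hqq hc _), one_smul]

/-- The middle part of `Δ(x_{a-1})` has primitive elements in both slots, so both iterated
comultiplications give the same terms whatever the middle coefficients are. -/
theorem explicitComul_coassoc (hn : n ≠ 0) (hπ : Compatible q a π) (h2 : π ^ 2 = 1)
    (hc : ScalarEquations q a π c) :
    TensorProduct.assoc K (Alg q a) (Alg q a) (Alg q a) ∘ₗ
        (explicitComul ha hq hqq π c).rTensor (Alg q a) ∘ₗ explicitComul ha hq hqq π c =
      (explicitComul ha hq hqq π c).lTensor (Alg q a) ∘ₗ explicitComul ha hq hqq π c := by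
  refine (monBasis ha hq hqq).ext fun v => ?_
  simp only [monBasis_apply, LinearMap.comp_apply, LinearEquiv.coe_coe]
  by_cases hv0 : (v : Fin n → ℕ) = 0
  · rw [hv0, mon_zero, explicitComul_one]
    simp only [LinearMap.rTensor_tmul, LinearMap.lTensor_tmul, explicitComul_one,
      TensorProduct.assoc_tmul]
  by_cases hvt : (v : Fin n → ℕ) = top a
  · have hM : ∑ v ∈ middle a, g q a π c v • (explicitComul ha hq hqq π c (mon q a (top a - v)) ⊗ₜ[K]
        mon q a (act π v)) = ∑ v ∈ middle a, g q a π c v •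
          ((1 ⊗ₜ[K] mon q a (top a - v) + mon q a (top a - v) ⊗ₜ[K] 1) ⊗ₜ[K] mon q a (act π v)) :=
      Finset.sum_congr rfl fun v hv => by
        rw [explicitComul_middle ha hq hqq (top_sub_mem_middle hv)]
    have hM' : ∑ v ∈ middle a, g q a π c v • (mon q a (top a - v) ⊗ₜ[K]
        explicitComul ha hq hqq π c (mon q a (act π v))) = ∑ v ∈ middle a, g q a π c v •
          (mon q a (top a - v) ⊗ₜ[K] (1 ⊗ₜ[K] mon q a (act π v) + mon q a (act π v) ⊗ₜ[K] 1)) :=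
      Finset.sum_congr rfl fun v hv => by
        rw [explicitComul_middle ha hq hqq (act_mem_middle hπ h2 hv)]
    rw [hvt]
    rw [explicitComul_top_eq_add ha hq hqq hn hπ hc]
    simp only [map_add, map_sum (LinearMap.rTensor _ _), map_sum (LinearMap.lTensor _ _), map_smul,
      LinearMap.rTensor_tmul, LinearMap.lTensor_tmul, explicitComul_one]
    rw [hM, hM', explicitComul_top_eq_add ha hq hqq hn hπ hc]
    simp only [map_add, map_sum, map_smul, TensorProduct.add_tmul, TensorProduct.tmul_add,
      TensorProduct.sum_tmul, TensorProduct.tmul_sum, ← TensorProduct.smul_tmul',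
      TensorProduct.tmul_smul, TensorProduct.assoc_tmul, smul_add, Finset.sum_add_distrib]
    abel
  · rw [explicitComul_middle ha hq hqq (mem_middle.2 ⟨v.2, hv0, hvt⟩)]
    simp only [map_add, LinearMap.rTensor_tmul, LinearMap.lTensor_tmul, explicitComul_one,
      TensorProduct.assoc_tmul, explicitComul_middle ha hq hqq (mem_middle.2 ⟨v.2, hv0, hvt⟩),
      TensorProduct.add_tmul, TensorProduct.tmul_add]
    abel

theorem rTensor_counit_explicitComul (hn : n ≠ 0) (hπ : Compatible q a π)
    (hc : ScalarEquations q a π c) :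
    (augmentation q ha).toLinearMap.rTensor (Alg q a) ∘ₗ explicitComul ha hq hqq π c =
      TensorProduct.mk K _ _ 1 := by
  have h0 := entry_ne_zero hqq
  refine (monBasis ha hq hqq).ext fun v => ?_
  simp only [monBasis_apply, LinearMap.comp_apply, TensorProduct.mk_apply]
  by_cases hv0 : (v : Fin n → ℕ) = 0
  · rw [hv0, mon_zero, explicitComul_one]
    simp
  by_cases hvt : (v : Fin n → ℕ) = top a
  · rw [hvt, explicitComul_top_eq_add ha hq hqq hn hπ hc]
    simp only [map_add, map_sum, map_smul, LinearMap.rTensor_tmul, AlgHom.toLinearMap_apply,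
      augmentation_mon ha h0, map_one, if_neg (top_ne_zero ha hn), TensorProduct.zero_tmul,
      zero_add]
    rw [Finset.sum_eq_zero, add_zero]
    intro w hw
    rw [if_neg (mem_middle.1 (top_sub_mem_middle hw)).2.1, TensorProduct.zero_tmul, smul_zero]
  · rw [explicitComul_middle ha hq hqq (mem_middle.2 ⟨v.2, hv0, hvt⟩)]
    simp [augmentation_mon ha h0, hv0]

theorem lTensor_counit_explicitComul (hn : n ≠ 0) (hπ : Compatible q a π) (h2 : π ^ 2 = 1)
    (hc : ScalarEquations q a π c) :
    (augmentation q ha).toLinearMap.lTensor (Alg q a) ∘ₗ explicitComul ha hq hqq π c =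
      (TensorProduct.mk K _ _).flip 1 := by
  have h0 := entry_ne_zero hqq
  refine (monBasis ha hq hqq).ext fun v => ?_
  simp only [monBasis_apply, LinearMap.comp_apply, TensorProduct.mk_apply, LinearMap.flip_apply]
  by_cases hv0 : (v : Fin n → ℕ) = 0
  · rw [hv0, mon_zero, explicitComul_one]
    simp
  by_cases hvt : (v : Fin n → ℕ) = top a
  · rw [hvt, explicitComul_top_eq_add ha hq hqq hn hπ hc]
    simp only [map_add, map_sum, map_smul, LinearMap.lTensor_tmul, AlgHom.toLinearMap_apply,
      augmentation_mon ha h0, map_one, if_neg (top_ne_zero ha hn), TensorProduct.tmul_zero,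
      add_zero]
    rw [Finset.sum_eq_zero, add_zero]
    intro w hw
    rw [if_neg (mem_middle.1 (act_mem_middle hπ h2 hw)).2.1, TensorProduct.tmul_zero, smul_zero]
  · rw [explicitComul_middle ha hq hqq (mem_middle.2 ⟨v.2, hv0, hvt⟩)]
    simp [augmentation_mon ha h0, hv0]

theorem explicitComul_antipode (hn : n ≠ 0) (hπ : Compatible q a π) (h2 : π ^ 2 = 1)
    (hc : ScalarEquations q a π c) (y : Alg q a) :
    explicitComul ha hq hqq π c (antipode hπ c y) =
      TensorProduct.map (antipode hπ c) (antipode hπ c)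
        (TensorProduct.comm K (Alg q a) (Alg q a) (explicitComul ha hq hqq π c y)) := by
  have h0 := entry_ne_zero hqq
  suffices hs : explicitComul ha hq hqq π c ∘ₗ antipode hπ c =
      TensorProduct.map (antipode hπ c) (antipode hπ c) ∘ₗ
        (TensorProduct.comm K (Alg q a) (Alg q a)).toLinearMap ∘ₗ explicitComul ha hq hqq π c from
    LinearMap.congr_fun hs y
  refine (monBasis ha hq hqq).ext fun v => ?_
  simp only [monBasis_apply, LinearMap.comp_apply, LinearEquiv.coe_coe]
  by_cases hv0 : (v : Fin n → ℕ) = 0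
  · rw [hv0, mon_zero, antipode_one, explicitComul_one]
    simp only [TensorProduct.comm_tmul, TensorProduct.map_tmul, antipode_one]
  by_cases hvt : (v : Fin n → ℕ) = top a
  · rw [hvt, antipode_mon_top hq hqq hπ hc, explicitComul_top ha hq hqq hn]
    simp only [map_sum, map_smul, TensorProduct.comm_tmul, TensorProduct.map_tmul,
      antipode_mon hq hqq, act_act h2, TensorProduct.smul_tmul_smul, smul_smul]
    -- Swapping the tensor factors matches the term of `v` with that of `a - 1 - v`; equality of
    -- coefficients is then `antipodeCoeff_mul_act`.
    refine Finset.sum_nbij' (fun v => top a - v) (fun v => top a - v)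
      (fun v _ => top_sub_mem_V v) (fun v _ => top_sub_mem_V v) ?_ ?_ ?_
    · intro w hw
      exact tsub_tsub_cancel_of_le (mem_V_iff_le.1 hw)
    · intro w hw
      exact tsub_tsub_cancel_of_le (mem_V_iff_le.1 hw)
    · intro w hw
      have hw' : top a - (top a - w) = w := tsub_tsub_cancel_of_le (mem_V_iff_le.1 hw)
      rw [hw']
      congr 1
      rw [g_eq ha hw, g_eq ha (top_sub_mem_V w), hw']
      have h1 := antipodeCoeff_mul_act ha hq hqq hπ h2 hc (top_sub_mem_V w)
      rw [hw'] at h1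
      have h3 := coeff_ne_zero h0 (fun i => (((top a - w) i : ℕ) : ℤ)) (fun i => (w i : ℤ))
      have h4 := coeff_ne_zero h0 (fun i => (w i : ℤ)) (fun i => (((top a - w) i : ℕ) : ℤ))
      rw [eq_div_iff h3] at h1
      field_simp
      linear_combination -antipodeCoeff q π c w * h1
  · have hm := mem_middle.2 ⟨v.2, hv0, hvt⟩
    rw [explicitComul_middle ha hq hqq hm, antipode_mon hq hqq, map_smul,
      explicitComul_middle ha hq hqq (act_mem_middle hπ h2 hm)]
    simp only [map_add, TensorProduct.comm_tmul, TensorProduct.map_tmul, antipode_one,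
      antipode_mon hq hqq, smul_add, TensorProduct.tmul_smul, TensorProduct.smul_tmul']
    abel

/-- `φ(x_{a-1-v} y)` is the coordinate of `y` at `v` times a structure constant, which the inverse
factor in `g` cancels. -/
theorem antipode_eq (hn : n ≠ 0) (hπ : Compatible q a π) (y : Alg q a) :
    antipode hπ c y = TensorProduct.lid K (Alg q a)
      (((monBasis ha hq hqq).coord ⟨top a, top_mem_V⟩ ∘ₗ LinearMap.mulRight K y).rTensor (Alg q a)
        (explicitComul ha hq hqq π c (mon q a (top a)))) := by
  have h0 := entry_ne_zero hqq
  rw [explicitComul_top ha hq hqq hn, ← Finset.sum_coe_sort]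
  simp only [map_sum, map_smul, LinearMap.rTensor_tmul, LinearMap.comp_apply,
    LinearMap.mulRight_apply, TensorProduct.lid_tmul,
    topDual_mon_mul ha hq hqq (isTopDual_coord ha hq hqq)]
  conv_lhs => rw [← (monBasis ha hq hqq).sum_repr y]
  simp only [map_sum, map_smul, monBasis_apply, antipode_mon hq hqq]
  refine Finset.sum_congr rfl fun v _ => ?_
  rw [g_eq ha v.2, smul_smul, smul_smul, Module.Basis.coord_apply]
  congr 1
  have := coeff_ne_zero h0 (fun i => (((top a - (v : Fin n → ℕ)) i : ℕ) : ℤ))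
    (fun i => ((v : Fin n → ℕ) i : ℤ))
  field_simp

theorem exists_mul_topDual (f : Module.Dual K (Alg q a)) : ∃ z, ∀ y,
    f y = (monBasis ha hq hqq).coord ⟨top a, top_mem_V⟩ (y * z) := by
  have h0 := entry_ne_zero hqq
  refine ⟨∑ v : {v // v ∈ V a}, (f (mon q a v) * (natCoeff q v (top a - v))⁻¹) •
    mon q a (top a - v), fun y => ?_⟩
  simp only [Finset.mul_sum, mul_smul_comm, map_sum, map_smul,
    topDual_mul_mon ha hq hqq (isTopDual_coord ha hq hqq)]
  conv_lhs => rw [← (monBasis ha hq hqq).sum_repr y]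
  simp only [map_sum, map_smul, monBasis_apply, smul_eq_mul]
  refine Finset.sum_congr rfl fun v _ => ?_
  rw [Module.Basis.coord_apply]
  have := coeff_ne_zero h0 (fun i => ((v : Fin n → ℕ) i : ℤ))
    (fun i => (((top a - (v : Fin n → ℕ)) i : ℕ) : ℤ))
  field_simp

/-- The bi-Frobenius structure attached to `π` and the scalars `c_i`. -/
noncomputable def explicitStructure (hn : n ≠ 0) (hπ : Compatible q a π) (h2 : π ^ 2 = 1)
    (hc : ScalarEquations q a π c) : BiFrobeniusStructure K (Alg q a) where
  comul := explicitComul ha hq hqq π c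
  counit := (augmentation q ha).toLinearMap
  coassoc := explicitComul_coassoc ha hq hqq hn hπ h2 hc
  rTensor_counit_comp_comul := rTensor_counit_explicitComul ha hq hqq hn hπ hc
  lTensor_counit_comp_comul := lTensor_counit_explicitComul ha hq hqq hn hπ h2 hc
  finite := Module.Finite.of_basis (monBasis ha hq hqq)
  φ := (monBasis ha hq hqq).coord ⟨top a, top_mem_V⟩
  t := mon q a (top a)
  S := antipode hπ c
  S_def := antipode_eq ha hq hqq hn hπ
  counit_one := map_one (augmentation q ha)
  counit_mul := map_mul (augmentation q ha)
  comul_one := explicitComul_one ha hq hqq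
  frobenius_algebra := exists_mul_topDual ha hq hqq
  -- By `antipode_eq`, every value of `S` has the form `t ↼ f`, and `S` is surjective.
  frobenius_coalgebra y := by
    obtain ⟨z, rfl⟩ := antipode_surjective ha hq hqq hπ h2 hc y
    exact ⟨_, antipode_eq ha hq hqq hn hπ z⟩
  S_one := antipode_one hπ
  S_mul := antipode_mul hπ
  counit_S := augmentation_antipode ha hπ
  comul_S := explicitComul_antipode ha hq hqq hn hπ h2 hc

theorem isExplicit_explicitStructure (hn : n ≠ 0) (hπ : Compatible q a π) (h2 : π ^ 2 = 1)
    (hc : ScalarEquations q a π c) :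
    IsExplicit π c (explicitStructure ha hq hqq hn hπ h2 hc) where
  φ_eq := isTopDual_coord ha hq hqq
  t_eq := rfl
  counit_eq v _ := augmentation_mon ha (entry_ne_zero hqq) v
  comul_one_eq := explicitComul_one ha hq hqq
  comul_eq _ hv h0 ht := explicitComul_middle ha hq hqq (mem_middle.2 ⟨hv, h0, ht⟩)
  comul_top := explicitComul_top ha hq hqq hn
  S_eq v _ := antipode_mon hq hqq hπ v

theorem isPermutationAntipode_explicitStructure (hn : n ≠ 0) (hπ : Compatible q a π)
    (h2 : π ^ 2 = 1) (hc : ScalarEquations q a π c) :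
    IsPermutationAntipode (explicitStructure ha hq hqq hn hπ h2 hc) :=
  ⟨⟨fun v => ⟨act π v, (act_mem_V hπ.1).2 v.2⟩, fun v => ⟨act π v, (act_mem_V hπ.1).2 v.2⟩,
    fun v => Subtype.ext (act_act h2 v), fun v => Subtype.ext (act_act h2 v)⟩,
    fun v => antipodeCoeff q π c v, fun v => antipode_mon hq hqq hπ v⟩

end Explicit

end QuantumCI

theorem theorem7p4 {K : Type*} [Field K] (hchar : ringChar K ≠ 2) (hi : ∀ z : K, z ^ 2 ≠ -1)
    (n : ℕ) (hn : 2 ≤ n) (a : Fin n → ℕ) (ha : ∀ i, 2 ≤ a i)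
    (q : Matrix (Fin n) (Fin n) K) (hq : ∀ i, q i i = 1) (hqq : ∀ i j, q i j * q j i = 1) :
    ((∃ B : BiFrobeniusStructure K (QuantumCI.Alg q a), QuantumCI.IsPermutationAntipode B) ↔
      QuantumCI.NakayamaSqEqId q a ∧
        ∃ π : Equiv.Perm (Fin n), QuantumCI.GoodInvolution q a π) ∧
    (QuantumCI.NakayamaSqEqId q a →
      ∀ π : Equiv.Perm (Fin n), QuantumCI.GoodInvolution q a π →
        (∃ c : Fin n → K, QuantumCI.ScalarEquations q a π c) ∧
        ∀ c : Fin n → K, QuantumCI.ScalarEquations q a π c →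
          ∃ B : BiFrobeniusStructure K (QuantumCI.Alg q a),
            QuantumCI.IsPermutationAntipode B ∧ QuantumCI.IsExplicit π c B) := by
  have hn0 : n ≠ 0 := by omega
  have hex : QuantumCI.NakayamaSqEqId q a → ∀ π : Equiv.Perm (Fin n),
      QuantumCI.GoodInvolution q a π → ∃ c : Fin n → K, QuantumCI.ScalarEquations q a π c :=
    fun hN π hπ => QuantumCI.exists_scalarEquations hi ha hq hqq hπ
      (QuantumCI.h_sq_of_nakayama ha hq hqq hN)
  refine ⟨⟨fun ⟨B, hB⟩ => QuantumCI.good_of_permutationAntipode ha hq hqq hi B hB, ?_⟩, ?_⟩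
  · rintro ⟨hN, π, hπ⟩
    obtain ⟨c, hc⟩ := hex hN π hπ
    exact ⟨_, QuantumCI.isPermutationAntipode_explicitStructure ha hq hqq hn0 hπ.1 hπ.2.1 hc⟩
  · intro hN π hπ
    exact ⟨hex hN π hπ, fun c hc =>
      ⟨_, QuantumCI.isPermutationAntipode_explicitStructure ha hq hqq hn0 hπ.1 hπ.2.1 hc,
        QuantumCI.isExplicit_explicitStructure ha hq hqq hn0 hπ.1 hπ.2.1 hc⟩⟩
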